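/- Let $d\ge 1$ and $q\ge 0$ be integers and let $p\in(2,\infty]$ with $p>2q+1$. Let $\mathcal K=(K^r)_{r\in\mathbb R}$ assign to every finite multiset $S$ of points of $\mathbb R^d$ a filtration $K^r(S)\subseteq K^t(S)$ ($r\le t$) of abstract simplicial complexes with vertices in $S$ (repeated points being distinct vertices), such that (K1) for all $r$, $S$ and $z\notin S$: $K^r(S)\subseteq K^r(S\cup\{z\})$, and every $\sigma\in K^r(S\cup\{z\})\setminus K^r(S)$ contains $z$; (D1) there is an increasing $\phi:\mathbb R\to[0,\infty)$ with $\operatorname{diam}\sigma\le\phi(r)$ for all $r$, $S$ and $\sigma\in K^r(S)$. For $\vec r=(r_1,\dots,r_k)\in\mathbb R^k$ put $\chi_q^{\vec r}(S)=\bigl(\chi_q^{r_i}(S)\bigr)_{i\le k}$, where $\chi_q^{r}(S)=\sum_{j=0}^q(-1)^j\,\#K^{r}_j(S)$ and $K_j^r(S)$ is the set of $j$-simplices ($j+1$ vertices) of $K^r(S)$; assume these functionals are measurable. For a distribution $P$ on $\mathbb R^d$ let $\mathcal L_n(P)$ be the law of $$\tfrac1{\sqrt n}\Bigl(\chi_q^{\vec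 r}(n^{1/d}\mathbf Z_n)-\mathbb E\,\chi_q^{\vec r}(n^{1/d}\mathbf Z_n)\Bigr),\qquad \mathbf Z_n=\{Z_1,\dots,Z_n\}\ \text{iid from } P,$$ and let $\mathcal L_n^i(P)$ be its $i$-th marginal. Let $F$ be a probability distribution on $\mathbb R^d$ with density $f$, $\|f\|_p<\infty$. **(Bootstrap consistency.)** Let $X_1,X_2,\dots$ be iid from $F$, and let $\hat F_n$ be an estimate of $F$ depending on $X_1,\dots,X_n$, which is a probability distribution with density $\hat f_n$, such that $\|\hat f_n-f\|_1\to0$ and $\|\hat f_n-f\|_p\to 0$ in probability (resp. almost surely). Let $m_n\in\mathbb N$ with $m_n\to\infty$, and let $G$ be a probability distribution on $\mathbb R^k$. The conditional law, given $X_1,\dots,X_n$, of the standardized statistic of a bootstrap sample of size $m_n$ from $\hat F_n$ is $\mathcal L_{m_n}(\hat F_n)$. Then, all convergences of laws being weak, 1. if $\mathcal L_n(F)\to G$, then $\mathcal L_{m_n}(\hat F_n)\to G$ in probability (resp. almost surely); 2. $\mathcal L_{m_n}(F)\to G$ if and only if $\mathcal L_{m_n}(\hat F_n)\to G$ in probability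 (resp. almost surely); 3. if every sufficiently large integer is a value of the sequence $(m_n)$ (for example if $m_n=n$), then $\mathcal L_n(F)\to G$ if and only if $\mathcal L_{m_n}(\hat F_n)\to G$ in probability (resp. almost surely). **(Rates.)** For every $M<\infty$ with $\|f\|_p\le M$ there is a function $\gamma$ of $\varepsilon>0$ such that, as $\varepsilon\to0$, $$\gamma_\varepsilon=O\Bigl(\varepsilon^{\frac{p-2}{p-1}\left(1-\frac{2q}{p-1}\right)}\Bigr)\ (p<\infty),\qquad \gamma_\varepsilon=O\Bigl(\varepsilon\Bigl(\tfrac{-\log\varepsilon}{\log(-\log\varepsilon)}\Bigr)^{2q}\Bigr)\ (p=\infty),$$ and such that for every $\varepsilon>0$ and every probability distribution $Q$ with a density of $L^p$ norm at most $M$ and total variation distance $d_{\mathrm{TV}}(F,Q)=\sup_A|F(A)-Q(A)|\le\varepsilon$ there are iid pairs $(X_j,Y_j)$, $j\ge1$, with $X_j\sim F$, $Y_j\sim Q$ and $$\operatorname{Var}\Bigl(\tfrac1{\sqrt n}\bigl(\chi_q^{r_i}(n^{1/d}\{X_1,\dots,X_n\})-\chi_q^{r_i}(n^{1/d}\{Y_1,\dots,Y_n\})\bigr)\Bigr)\le\gamma_\varepsilon\qquad\text{for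 all } n\ge1,\ i\le k;$$ moreover $W_2\bigl(\mathcal L_n^i(F),\mathcal L_n^i(Q)\bigr)\le\sqrt{\gamma_\varepsilon}$ for all $n\ge1$ and $i\le k$, where $W_2$ is the 2-Wasserstein distance. -/

import Mathlib

open MeasureTheory ProbabilityTheory Filter Topology Asymptotics
open scoped ENNReal NNReal BoundedContinuousFunction

noncomputable section

namespace TruncEuler

/-- Euclidean space `ℝ^d`. -/
abbrev E (d : ℕ) : Type := EuclideanSpace ℝ (Fin d)

/-- A function assigning to every `r : ℝ` and every finite multiset `S` of points of `ℝ^d` an abstract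
simplicial complex. Repeated points of `S` count as distinct vertices, so a vertex is a pair `(x, j)`,
the `j`-th copy of the point `x`. Faces are nonempty; not every vertex has to be a face. -/
abbrev ComplexFamily (d : ℕ) : Type := ℝ → Multiset (E d) → PreAbstractSimplicialComplex (E d × ℕ)

open Classical in
/-- For every `S`, the complexes `K r S` have their vertices in `S` (the copies `(x, j)` with
`j < S.count x`), and they increase with `r`. -/
def IsFiltration {d : ℕ} (K : ComplexFamily d) : Prop :=
  (∀ r S, ∀ σ ∈ (K r S).faces, σ ⊆ S.toEnumFinset) ∧ ∀ S r t, r ≤ t → K r S ≤ K t S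

/-- Adding a new point `z ∉ S` removes no simplex, and every simplex that it adds contains `z`. -/
def CondK1 {d : ℕ} (K : ComplexFamily d) : Prop :=
  ∀ (r : ℝ) (S : Multiset (E d)) (z : E d), z ∉ S →
    K r S ≤ K r (z ::ₘ S) ∧
      ∀ σ ∈ (K r (z ::ₘ S)).faces, σ ∉ (K r S).faces → ∃ v ∈ σ, v.1 = z

/-- The simplices of `K r S` have diameter at most `φ r`, for all `S`. -/
def CondD1 {d : ℕ} (K : ComplexFamily d) : Prop :=
  ∃ φ : ℝ → ℝ≥0, Monotone φ ∧ ∀ (r : ℝ) (S : Multiset (E d)), ∀ σ ∈ (K r S).faces,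
    Metric.diam (Prod.fst '' (σ : Set (E d × ℕ))) ≤ φ r

/-- The `q`-truncated Euler characteristic `∑_{k ≤ q} (-1)^k #K_k`, where `K_k` consists of the simplices
with `k + 1` vertices. -/
def truncEuler {V : Type*} (q : ℕ) (K : PreAbstractSimplicialComplex V) : ℝ :=
  ∑ k ∈ Finset.range (q + 1), (-1) ^ k * ({σ ∈ K.faces | σ.card = k + 1}.ncard : ℝ)

/-- The multiset `n^{1/d} {x_1, …, x_n}`. -/
def scaledSample {d : ℕ} (n : ℕ) (x : Fin n → E d) : Multiset (E d) :=
  Finset.univ.val.map fun i => ((n : ℝ) ^ ((d : ℝ)⁻¹)) • x i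

/-- A functional of finite multisets is measurable if it is so on samples of every fixed size. -/
def MeasurableFunctional {d : ℕ} (ψ : Multiset (E d) → ℝ) : Prop :=
  ∀ n : ℕ, Measurable fun x : Fin n → E d => ψ (Finset.univ.val.map x)

/-- The law of an iid sample of size `n` from `P`. -/
abbrev sampleLaw {d : ℕ} (n : ℕ) (P : Measure (E d)) : Measure (Fin n → E d) :=
  Measure.pi fun _ => P

/-- `n^{-1/2} (ψ(n^{1/d} x) - 𝔼 ψ(n^{1/d} 𝐗_n))` for a point `x` of the sample space, where `𝐗_n` is an
iid sample of size `n` from `P`. -/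
def standardized {d : ℕ} (ψ : Multiset (E d) → ℝ) (n : ℕ) (P : Measure (E d)) (x : Fin n → E d) : ℝ :=
  (√(n : ℝ))⁻¹ * (ψ (scaledSample n x) - ∫ y, ψ (scaledSample n y) ∂(sampleLaw n P))

/-- The law of the real statistic `n^{-1/2} (ψ(n^{1/d} 𝐗_n) - 𝔼 ψ(n^{1/d} 𝐗_n))`, `𝐗_n` iid from `P`. -/
def standardizedLaw {d : ℕ} (ψ : Multiset (E d) → ℝ) (n : ℕ) (P : Measure (E d)) : Measure ℝ :=
  (sampleLaw n P).map (standardized ψ n P)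

/-- The joint law of the `k` standardized statistics belonging to `ψ 1, …, ψ k`. For `P = F` this is the
sampling distribution. -/
def standardizedJointLaw {d k : ℕ} (ψ : Fin k → Multiset (E d) → ℝ) (n : ℕ) (P : Measure (E d)) :
    Measure (Fin k → ℝ) :=
  (sampleLaw n P).map fun x i => standardized (ψ i) n P x

/-- The conditional law, given the data `X_1, …, X_n`, of the standardized statistics of a bootstrap
sample of size `m n` drawn from the estimated distribution `F̂_n(X_1, …, X_n)`. -/
def bootstrapLaw {d k : ℕ} {Ω : Type*} (ψ : Fin k → Multiset (E d) → ℝ) (m : ℕ → ℕ)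
    (Fhat : (n : ℕ) → (Fin n → E d) → Measure (E d)) (X : ℕ → Ω → E d) (n : ℕ) (ω : Ω) :
    Measure (Fin k → ℝ) :=
  standardizedJointLaw ψ (m n) (Fhat n fun i => X i ω)

/-- The error `‖f̂_n - f‖_s` of the density estimator. -/
def densityError {d : ℕ} {Ω : Type*} (s : ℝ≥0∞) (fhat : (n : ℕ) → (Fin n → E d) → E d → ℝ)
    (f : E d → ℝ) (X : ℕ → Ω → E d) (n : ℕ) (ω : Ω) : ℝ≥0∞ :=
  eLpNorm (fun y => fhat n (fun i => X i ω) y - f y) s volume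

/-- Weak convergence of a sequence of laws. -/
def WeakConv {k : ℕ} (L : ℕ → Measure (Fin k → ℝ)) (G : Measure (Fin k → ℝ)) : Prop :=
  ∀ v : (Fin k → ℝ) →ᵇ ℝ, Tendsto (fun n => ∫ t, v t ∂(L n)) atTop (𝓝 (∫ t, v t ∂G))

/-- Weak convergence, in probability, of a sequence of random laws. -/
def WeakConvInProb {Ω : Type*} [MeasurableSpace Ω] (μ : Measure Ω) {k : ℕ}
    (L : ℕ → Ω → Measure (Fin k → ℝ)) (G : Measure (Fin k → ℝ)) : Prop :=
  ∀ v : (Fin k → ℝ) →ᵇ ℝ,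
    TendstoInMeasure μ (fun n ω => ∫ t, v t ∂(L n ω)) atTop (fun _ => ∫ t, v t ∂G)

/-- Weak convergence, almost surely, of a sequence of random laws. -/
def WeakConvAS {Ω : Type*} [MeasurableSpace Ω] (μ : Measure Ω) {k : ℕ}
    (L : ℕ → Ω → Measure (Fin k → ℝ)) (G : Measure (Fin k → ℝ)) : Prop :=
  ∀ᵐ ω ∂μ, WeakConv (fun n => L n ω) G

/-- Convergence to `0` in probability of `[0, ∞]`-valued random quantities. -/
def ToZeroInProb {Ω : Type*} [MeasurableSpace Ω] (μ : Measure Ω) (Z : ℕ → Ω → ℝ≥0∞) : Prop :=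
  ∀ δ : ℝ≥0∞, 0 < δ → Tendsto (fun n => μ {ω | δ ≤ Z n ω}) atTop (𝓝 0)

/-- Almost sure convergence to `0` of `[0, ∞]`-valued random quantities. -/
def ToZeroAS {Ω : Type*} [MeasurableSpace Ω] (μ : Measure Ω) (Z : ℕ → Ω → ℝ≥0∞) : Prop :=
  ∀ᵐ ω ∂μ, Tendsto (fun n => Z n ω) atTop (𝓝 0)

/-- `P` is a probability distribution on `ℝ^d` with Lebesgue density `g`. -/
def IsDensity {d : ℕ} (g : E d → ℝ) (P : Measure (E d)) : Prop :=
  IsProbabilityMeasure P ∧ Measurable g ∧ (∀ x, 0 ≤ g x) ∧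
    P = volume.withDensity fun x => ENNReal.ofReal (g x)

/-- The class of probability distributions with a density `g` such that `‖g‖_p ≤ M`. -/
def DensityClass (d : ℕ) (p : ℝ≥0∞) (M : ℝ≥0) : Set (Measure (E d)) :=
  {P | ∃ g : E d → ℝ, IsDensity g P ∧ eLpNorm g p volume ≤ M}

/-- Total variation distance `sup_A |P(A) - Q(A)|`. -/
def tvDist {α : Type*} [MeasurableSpace α] (P Q : Measure α) : ℝ :=
  ⨆ A : {A : Set α // MeasurableSet A}, |P.real A - Q.real A|

/-- `π` is a coupling of `P` and `Q`. -/
def IsCoupling {α : Type*} [MeasurableSpace α] (π : Measure (α × α)) (P Q : Measure α) : Prop :=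
  π.map Prod.fst = P ∧ π.map Prod.snd = Q

/-- 2-Wasserstein distance between laws on `ℝ`. -/
def W2 (P Q : Measure ℝ) : ℝ≥0∞ :=
  (⨅ π ∈ {π : Measure (ℝ × ℝ) | IsCoupling π P Q},
    ∫⁻ w, ENNReal.ofReal ((w.1 - w.2) ^ 2) ∂π) ^ (1 / 2 : ℝ)

/-- The rate of the squared 2-Wasserstein distance, as a function of the total variation distance. -/
def rate (q : ℕ) (p : ℝ≥0∞) (ε : ℝ) : ℝ :=
  open Classical in
  if p = ∞ then ε * (-Real.log ε / Real.log (-Real.log ε)) ^ (2 * q)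
  else ε ^ ((p.toReal - 2) / (p.toReal - 1) * (1 - 2 * q / (p.toReal - 1)))

end TruncEuler

end

/-! Everything rests on one variance estimate for coupled samples, uniform in the sample size.
Couple `F` and `Q` maximally, so that a pair is off the diagonal with probability at most ε, and
apply the Efron–Stein inequality to the difference of the two statistics, comparing it with the same
difference after deletion of one pair (`evariance_coupled_le`). By (K1) and (D1), the effect of one
new point on the truncated Euler characteristic depends only on the N sample points within distance
ρ, and it is at most (q+1)(1+N)^q. Deleting a pair therefore leaves the difference unchanged unless
that pair, or one near it, is off the diagonal. So the variance is at most a constant times the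
expectation of (1+N)^{2q} over this discrepancy event A, summed over the two marginals
(`pairMoment`).

Given its centre, N is binomial with mean at most the intensity, which is n times the mass of a ball
of radius ρ n^{-1/d}. An L^p bound on the density controls the moment of order s = p-1 of the
intensity at a random point, uniformly in n. Hölder's inequality, used twice, gives P(A) ≲ ε^{1-1/s}
and then E[(1+N)^{2q}; A] ≲ P(A)^{1-2q/s}. The product of the two exponents is the stated rate; it
is positive because p > 2 and p > 2q+1. For p = ∞ the intensities are bounded, P(A) ≲ ε, and N has
Poisson-like tails; instead of Hölder's inequality, 1+N is truncated at level 4a / log a with a =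
-log ε.

For the Wasserstein bound, the coupled standardized statistics form a coupling whose mean squared
distance is the variance just estimated. For the bootstrap, the same coupling bounds the difference
of integrals of bounded Lipschitz functions under the two laws, uniformly in the sample size and
over all `Q` with density close to f in L^1 and L^p (`uniformlyClose_lawsNear`). Hence the laws
under F and under the estimate merge along `m n`, whether or not either converges. This is item 2;
items 1 and 3 follow by deterministic passage between `n` and `m n`. -/

noncomputable section

namespace TruncEuler

/-! ### Locality and size of the add-one cost. -/

section Combinatorics

variable {α : Type*} [MetricSpace α] {L : Multiset α → PreAbstractSimplicialComplex (α × ℕ)}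

open Classical in
/-- The vertices of `L S` lie in `S`. -/
def VerticesIn (L : Multiset α → PreAbstractSimplicialComplex (α × ℕ)) : Prop :=
  ∀ S, ∀ σ ∈ (L S).faces, σ ⊆ S.toEnumFinset

/-- Adding a new point `z` only adds simplices with vertex `z`. -/
def AddsStar (L : Multiset α → PreAbstractSimplicialComplex (α × ℕ)) : Prop :=
  ∀ (S : Multiset α) (z : α), z ∉ S → L S ≤ L (z ::ₘ S) ∧
    ∀ σ ∈ (L (z ::ₘ S)).faces, σ ∉ (L S).faces → ∃ v ∈ σ, v.1 = z

/-- All simplices have diameter at most `ρ`. -/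
def DiamLE (L : Multiset α → PreAbstractSimplicialComplex (α × ℕ)) (ρ : ℝ) : Prop :=
  ∀ S, ∀ σ ∈ (L S).faces, Metric.diam (Prod.fst '' (σ : Set (α × ℕ))) ≤ ρ

/-- The simplices which the new point `z` adds to `L S`. -/
def newFaces (L : Multiset α → PreAbstractSimplicialComplex (α × ℕ)) (z : α) (S : Multiset α) :
    Set (Finset (α × ℕ)) :=
  (L (z ::ₘ S)).faces \ (L S).faces

lemma DiamLE.dist_le {ρ : ℝ} (hD : DiamLE L ρ) {S : Multiset α} {σ : Finset (α × ℕ)}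
    (hσ : σ ∈ (L S).faces) {v w : α × ℕ} (hv : v ∈ σ) (hw : w ∈ σ) : dist v.1 w.1 ≤ ρ :=
  (Metric.dist_le_diam_of_mem ((σ.finite_toSet.image _).isBounded)
    ⟨v, hv, rfl⟩ ⟨w, hw, rfl⟩).trans (hD S σ hσ)

/-- A simplex whose status as a new face of `z` changes when `w` is added must contain both `z` and
`w`, which the diameter bound forbids. -/
lemma newFaces_cons_of_lt_dist {ρ : ℝ} (hK : AddsStar L) (hD : DiamLE L ρ) {S : Multiset α}
    {z w : α} (hz : z ∉ S) (hw : w ∉ z ::ₘ S) (hd : ρ < dist z w) :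
    newFaces L z (w ::ₘ S) = newFaces L z S := by
  have hwS : w ∉ S := fun h => hw (Multiset.mem_cons_of_mem h)
  have hzw : z ∉ w ::ₘ S := by
    intro h
    rcases Multiset.mem_cons.1 h with rfl | h
    · exact hw (Multiset.mem_cons_self _ _)
    · exact hz h
  ext σ
  constructor
  · rintro ⟨h1, h2⟩
    obtain ⟨v, hv, hvz⟩ := (hK _ z hzw).2 σ h1 h2
    refine ⟨?_, fun h => h2 ((hK S w hwS).1 h)⟩
    by_contra hn
    have h1' := h1
    rw [Multiset.cons_swap] at h1'
    obtain ⟨u, hu, huw⟩ := (hK _ w hw).2 σ h1' hn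
    have := hD.dist_le h1 hv hu
    rw [hvz, huw] at this
    linarith
  · rintro ⟨h1, h2⟩
    obtain ⟨v, hv, hvz⟩ := (hK _ z hz).2 σ h1 h2
    refine ⟨?_, fun h => ?_⟩
    · rw [Multiset.cons_swap]
      exact (hK _ w hw).1 h1
    · obtain ⟨u, hu, huw⟩ := (hK S w hwS).2 σ h h2
      have := hD.dist_le h1 hv hu
      rw [hvz, huw] at this
      linarith

open Classical in
/-- The points of `S` at distance at most `ρ` from `z`. -/
def nearPart (ρ : ℝ) (z : α) (S : Multiset α) : Multiset α :=
  S.filter fun x => dist z x ≤ ρ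

/-- Far points never share a simplex with `z`, so they can be dropped one by one. Distinctness
matters because (K1) speaks only of points not yet present. -/
lemma newFaces_nearPart {ρ : ℝ} (hK : AddsStar L) (hD : DiamLE L ρ) {S : Multiset α} {z : α}
    (h : (z ::ₘ S).Nodup) : newFaces L z S = newFaces L z (nearPart ρ z S) := by
  classical
  -- adding back the far points one at a time
  suffices H : ∀ T : Multiset α, (∀ x ∈ T, ρ < dist z x) → ∀ R : Multiset α,
      (z ::ₘ (T + R)).Nodup → newFaces L z (T + R) = newFaces L z R by
    have hS : S.filter (fun x => ¬ dist z x ≤ ρ) + nearPart ρ z S = S := by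
      rw [add_comm]
      exact Multiset.filter_add_not _ S
    have := H (S.filter fun x => ¬ dist z x ≤ ρ)
      (fun x hx => not_le.1 (Multiset.mem_filter.1 hx).2) (nearPart ρ z S) (by rwa [hS])
    rwa [hS] at this
  intro T
  induction T using Multiset.induction_on with
  | empty => intro _ R _; simp
  | cons w T ih =>
    intro hT R hn
    rw [Multiset.cons_add] at hn ⊢
    rw [Multiset.cons_swap, Multiset.nodup_cons] at hn
    have hn2 := Multiset.nodup_cons.1 hn.2
    rw [newFaces_cons_of_lt_dist hK hD hn2.1 hn.1 (hT w (Multiset.mem_cons_self _ _))]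
    exact ih (fun x hx => hT x (Multiset.mem_cons_of_mem hx)) R hn.2

omit [MetricSpace α] in
lemma VerticesIn.finite_faces (hV : VerticesIn L) (S : Multiset α) : (L S).faces.Finite := by
  classical
  refine (S.toEnumFinset.powerset.finite_toSet).subset fun σ hσ => ?_
  have := hV S σ hσ
  simp only [Finset.coe_powerset, Set.mem_preimage, Set.mem_powerset_iff, Finset.coe_subset]
  convert this

omit [MetricSpace α] in
lemma truncEuler_cons_sub (hV : VerticesIn L) (hK : AddsStar L) (q : ℕ) {S : Multiset α} {z : α}
    (hz : z ∉ S) :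
    truncEuler q (L (z ::ₘ S)) - truncEuler q (L S) =
      ∑ k ∈ Finset.range (q + 1), (-1) ^ k * ({σ ∈ newFaces L z S | σ.card = k + 1}.ncard : ℝ) := by
  rw [truncEuler, truncEuler, ← Finset.sum_sub_distrib]
  refine Finset.sum_congr rfl fun k _ => ?_
  rw [← mul_sub]
  congr 1
  have hsub : {σ ∈ (L S).faces | σ.card = k + 1} ⊆ {σ ∈ (L (z ::ₘ S)).faces | σ.card = k + 1} :=
    fun σ hσ => ⟨(hK S z hz).1 hσ.1, hσ.2⟩
  have hfin : {σ ∈ (L (z ::ₘ S)).faces | σ.card = k + 1}.Finite :=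
    (hV.finite_faces _).subset fun σ hσ => hσ.1
  have hdiff : {σ ∈ newFaces L z S | σ.card = k + 1} =
      {σ ∈ (L (z ::ₘ S)).faces | σ.card = k + 1} \ {σ ∈ (L S).faces | σ.card = k + 1} := by
    ext σ
    simp only [newFaces, Set.mem_sdiff, Set.mem_ofPred_eq]
    tauto
  rw [hdiff, ← Set.ncard_sdiff_add_ncard_of_subset hsub hfin]
  push_cast
  ring

omit [MetricSpace α] in
-- Since `z ∉ S`, the only copy of `z` is `(z, 0)`. Erasing it maps the new `k`-simplices
-- injectively to `k`-subsets of the vertices of `S`.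
lemma ncard_newFaces_le (hV : VerticesIn L) (hK : AddsStar L) {S : Multiset α} {z : α}
    (hz : z ∉ S) (k : ℕ) :
    {σ ∈ newFaces L z S | σ.card = k + 1}.ncard ≤ S.card ^ k := by
  classical
  have key : ∀ σ ∈ {σ ∈ newFaces L z S | σ.card = k + 1},
      (z, 0) ∈ σ ∧ σ.erase (z, 0) ⊆ S.toEnumFinset := by
    rintro σ ⟨⟨h1, h2⟩, -⟩
    have hc : (z ::ₘ S).count z = 1 := by
      rw [Multiset.count_cons_self, Multiset.count_eq_zero_of_notMem hz]
    have hsub : ∀ v ∈ σ, v.2 < (z ::ₘ S).count v.1 := by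
      intro v hv
      have := hV _ σ h1 hv
      rw [Multiset.mem_toEnumFinset] at this
      convert this
    have hz0 : ∀ v ∈ σ, v.1 = z → v = (z, 0) := by
      intro v hv hvz
      have := hsub v hv
      rw [hvz, hc] at this
      exact Prod.ext hvz (by simpa using this)
    constructor
    · obtain ⟨v, hv, hvz⟩ := (hK S z hz).2 σ h1 h2
      rwa [hz0 v hv hvz] at hv
    · intro v hv
      obtain ⟨hne, hv⟩ := Finset.mem_erase.1 hv
      have := hsub v hv
      rw [Multiset.count_cons_of_ne (fun h => hne (hz0 v hv h))] at this
      exact (Multiset.mem_toEnumFinset _ _).2 this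
  calc {σ ∈ newFaces L z S | σ.card = k + 1}.ncard
      ≤ ((S.toEnumFinset.powersetCard k : Finset _) : Set (Finset (α × ℕ))).ncard := by
        refine Set.ncard_le_ncard_of_injOn (fun σ => σ.erase (z, 0)) ?_ ?_ (Finset.finite_toSet _)
        · intro σ hσ
          have := key σ hσ
          rw [Finset.mem_coe, Finset.mem_powersetCard]
          refine ⟨this.2, ?_⟩
          rw [Finset.card_erase_of_mem this.1, hσ.2]
          rfl
        · intro σ hσ τ hτ h
          have h' : σ.erase (z, 0) = τ.erase (z, 0) := h
          rw [← Finset.insert_erase (key σ hσ).1, h', Finset.insert_erase (key τ hτ).1]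
    _ = S.card.choose k := by
        rw [Set.ncard_coe_finset, Finset.card_powersetCard, Multiset.card_toEnumFinset]
    _ ≤ S.card ^ k := Nat.choose_le_pow _ _

/-- By locality the new simplices may be counted in the complex on the near points alone; each
dimension `k ≤ q` then contributes at most a `k`-th power of their number. -/
lemma abs_truncEuler_cons_sub_le {ρ : ℝ} (hV : VerticesIn L) (hK : AddsStar L) (hD : DiamLE L ρ)
    (q : ℕ) {S : Multiset α} {z : α} (h : (z ::ₘ S).Nodup) :
    |truncEuler q (L (z ::ₘ S)) - truncEuler q (L S)| ≤
      (q + 1) * (1 + ((nearPart ρ z S).card : ℝ)) ^ q := by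
  have hz : z ∉ S := (Multiset.nodup_cons.1 h).1
  have hz' : z ∉ nearPart ρ z S := fun h => hz (Multiset.mem_of_mem_filter h)
  rw [truncEuler_cons_sub hV hK q hz, newFaces_nearPart hK hD h]
  refine (Finset.abs_sum_le_sum_abs _ _).trans ?_
  have : ∀ k ∈ Finset.range (q + 1),
      |(-1) ^ k * ({σ ∈ newFaces L z (nearPart ρ z S) | σ.card = k + 1}.ncard : ℝ)| ≤
        (1 + ((nearPart ρ z S).card : ℝ)) ^ q := by
    intro k hk
    rw [abs_mul, abs_pow, abs_neg, abs_one, one_pow, one_mul, Nat.abs_cast]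
    calc ({σ ∈ newFaces L z (nearPart ρ z S) | σ.card = k + 1}.ncard : ℝ)
        ≤ ((nearPart ρ z S).card : ℝ) ^ k := mod_cast ncard_newFaces_le hV hK hz' k
      _ ≤ (1 + ((nearPart ρ z S).card : ℝ)) ^ k := by gcongr; linarith
      _ ≤ (1 + ((nearPart ρ z S).card : ℝ)) ^ q := by
        gcongr
        · linarith [(Nat.cast_nonneg (nearPart ρ z S).card : (0 : ℝ) ≤ _)]
        · exact Nat.lt_succ_iff.1 (Finset.mem_range.1 hk)
  refine (Finset.sum_le_sum this).trans ?_
  simp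

lemma truncEuler_cons_sub_congr {ρ : ℝ} (hV : VerticesIn L) (hK : AddsStar L) (hD : DiamLE L ρ)
    (q : ℕ) {S T : Multiset α} {z : α} (hS : (z ::ₘ S).Nodup) (hT : (z ::ₘ T).Nodup)
    (h : nearPart ρ z S = nearPart ρ z T) :
    truncEuler q (L (z ::ₘ S)) - truncEuler q (L S) =
      truncEuler q (L (z ::ₘ T)) - truncEuler q (L T) := by
  rw [truncEuler_cons_sub hV hK q (Multiset.nodup_cons.1 hS).1,
    truncEuler_cons_sub hV hK q (Multiset.nodup_cons.1 hT).1, newFaces_nearPart hK hD hS,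
    newFaces_nearPart hK hD hT, h]

omit [MetricSpace α] in
-- A crude bound that serves only integrability; it never enters the rates.
lemma abs_truncEuler_le (hV : VerticesIn L) (q : ℕ) (S : Multiset α) :
    |truncEuler q (L S)| ≤ (q + 1) * 2 ^ S.card := by
  classical
  refine (Finset.abs_sum_le_sum_abs _ _).trans ?_
  have : ∀ k ∈ Finset.range (q + 1),
      |(-1) ^ k * ({σ ∈ (L S).faces | σ.card = k + 1}.ncard : ℝ)| ≤ 2 ^ S.card := by
    intro k _
    rw [abs_mul, abs_pow, abs_neg, abs_one, one_pow, one_mul, Nat.abs_cast]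
    have h : {σ ∈ (L S).faces | σ.card = k + 1}.ncard ≤
        ((S.toEnumFinset.powerset : Finset _) : Set (Finset (α × ℕ))).ncard := by
      refine Set.ncard_le_ncard (fun σ hσ => ?_) (Finset.finite_toSet _)
      have := hV S σ hσ.1
      rw [Finset.mem_coe, Finset.mem_powerset]
      convert this
    rw [Set.ncard_coe_finset, Finset.card_powerset, Multiset.card_toEnumFinset] at h
    exact_mod_cast h
  refine (Finset.sum_le_sum this).trans ?_
  simp

end Combinatorics

/-! ### The Efron–Stein inequality. -/

section EfronStein

/-- The mean squared deviation from a constant, decomposed into variance and squared bias. -/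
lemma lintegral_sub_const_sq {α : Type*} [MeasurableSpace α] (μ : Measure α)
    [IsProbabilityMeasure μ] {u : α → ℝ} (hu : MemLp u 2 μ) (c : ℝ) :
    ∫⁻ x, ENNReal.ofReal ((u x - c) ^ 2) ∂μ =
      evariance u μ + ENNReal.ofReal ((∫ x, u x ∂μ - c) ^ 2) := by
  have hi : Integrable u μ := hu.integrable (by norm_num)
  have huc : MemLp (fun x => u x - c) 2 μ := hu.sub (memLp_const c)
  have h1 : Var[fun x => u x - c; μ] = Var[u; μ] := variance_sub_const hu.1 c
  rw [variance_eq_sub huc, integral_sub hi (integrable_const c)] at h1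
  simp only [integral_const, probReal_univ, one_smul, Pi.pow_apply] at h1
  rw [← hu.ofReal_variance_eq, ← ENNReal.ofReal_add (variance_nonneg _ _) (sq_nonneg _),
    ← ofReal_integral_eq_lintegral_ofReal huc.integrable_sq (ae_of_all _ fun _ => sq_nonneg _)]
  congr 1
  linarith

lemma evariance_le_lintegral_sub_sq {α : Type*} [MeasurableSpace α] (μ : Measure α)
    [IsProbabilityMeasure μ] {u : α → ℝ} (hu : MemLp u 2 μ) (c : ℝ) :
    evariance u μ ≤ ∫⁻ x, ENNReal.ofReal ((u x - c) ^ 2) ∂μ := by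
  rw [lintegral_sub_const_sq μ hu c]
  exact le_self_add

lemma memLp_of_abs_le {α : Type*} [MeasurableSpace α] {μ : Measure α} [IsFiniteMeasure μ]
    {u : α → ℝ} (hu : Measurable u) {B : ℝ} (hB : ∀ x, |u x| ≤ B) (s : ℝ≥0∞) : MemLp u s μ :=
  MemLp.of_bound hu.aestronglyMeasurable B (ae_of_all _ hB)

lemma measurable_integral_snd {α β : Type*} [MeasurableSpace α] [MeasurableSpace β]
    (ν : Measure β) [SFinite ν] {H : α × β → ℝ} (hH : Measurable H) :
    Measurable fun x => ∫ y, H (x, y) ∂ν :=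
  hH.stronglyMeasurable.integral_prod_right'.measurable

lemma measurable_integral_fst {α β : Type*} [MeasurableSpace α] [MeasurableSpace β]
    (μ : Measure α) [SFinite μ] {H : α × β → ℝ} (hH : Measurable H) :
    Measurable fun y => ∫ x, H (x, y) ∂μ :=
  (hH.comp measurable_swap).stronglyMeasurable.integral_prod_right'.measurable

/-- Subadditivity of the variance over two independent factors. -/
lemma evariance_prod_le {α β : Type*} [MeasurableSpace α] [MeasurableSpace β]
    (μ : Measure α) (ν : Measure β) [IsProbabilityMeasure μ] [IsProbabilityMeasure ν]
    {H : α × β → ℝ} (hH : Measurable H) {B : ℝ} (hB : ∀ x, |H x| ≤ B) :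
    evariance H (μ.prod ν) ≤ ∫⁻ y, evariance (fun x => H (x, y)) μ ∂ν +
      ∫⁻ x, evariance (fun y => H (x, y)) ν ∂μ := by
  have hx : ∀ y, MemLp (fun x => H (x, y)) 2 μ := fun y =>
    memLp_of_abs_le (by fun_prop) (fun x => hB _) 2
  have hy : ∀ x, MemLp (fun y => H (x, y)) 2 ν := fun x =>
    memLp_of_abs_le (by fun_prop) (fun x => hB _) 2
  have hbm := measurable_integral_fst μ hH
  have ham := measurable_integral_snd ν hH
  have hb : ∀ y, |∫ x, H (x, y) ∂μ| ≤ B := fun y => by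
    have := norm_integral_le_of_norm_le_const (μ := μ) (f := fun x => H (x, y)) (C := B)
      (ae_of_all _ fun x => hB _)
    simpa using this
  set m : ℝ := ∫ w, H w ∂(μ.prod ν) with hm
  have hmint : m = ∫ y, ∫ x, H (x, y) ∂μ ∂ν :=
    integral_prod_symm _ ((memLp_of_abs_le hH hB 1).integrable le_rfl)
  -- Jensen: for fixed `x`, the mean over `y` of `H (x, y)` minus its `x`-average is the conditional
  -- mean at `x` minus `m`.
  have hbias : ∀ x, ENNReal.ofReal ((∫ y, H (x, y) ∂ν - m) ^ 2) ≤
      ∫⁻ y, ENNReal.ofReal ((H (x, y) - ∫ x, H (x, y) ∂μ) ^ 2) ∂ν := by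
    intro x
    have hmem : MemLp (fun y => H (x, y) - ∫ x, H (x, y) ∂μ) 2 ν :=
      (hy x).sub (memLp_of_abs_le hbm hb 2)
    have h := lintegral_sub_const_sq ν hmem 0
    simp only [sub_zero] at h
    rw [h, integral_sub ((hy x).integrable (by norm_num))
      ((memLp_of_abs_le hbm hb 2).integrable (by norm_num)), ← hmint]
    exact le_add_self
  rw [evariance_eq_lintegral_ofReal, lintegral_prod _ (by fun_prop)]
  simp_rw [← hm]
  calc ∫⁻ x, ∫⁻ y, ENNReal.ofReal ((H (x, y) - m) ^ 2) ∂ν ∂μ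
      = ∫⁻ x, (evariance (fun y => H (x, y)) ν +
          ENNReal.ofReal ((∫ y, H (x, y) ∂ν - m) ^ 2)) ∂μ :=
        lintegral_congr fun x => lintegral_sub_const_sq ν (hy x) m
    _ = ∫⁻ x, evariance (fun y => H (x, y)) ν ∂μ +
          ∫⁻ x, ENNReal.ofReal ((∫ y, H (x, y) ∂ν - m) ^ 2) ∂μ :=
        lintegral_add_right _ (by fun_prop)
    _ ≤ ∫⁻ x, evariance (fun y => H (x, y)) ν ∂μ +
          ∫⁻ x, ∫⁻ y, ENNReal.ofReal ((H (x, y) - ∫ x, H (x, y) ∂μ) ^ 2) ∂ν ∂μ := by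
        gcongr with x
        exact hbias x
    _ = ∫⁻ x, evariance (fun y => H (x, y)) ν ∂μ +
          ∫⁻ y, ∫⁻ x, ENNReal.ofReal ((H (x, y) - ∫ x, H (x, y) ∂μ) ^ 2) ∂μ ∂ν := by
        rw [lintegral_lintegral_swap]
        have : Measurable fun w : α × β => ENNReal.ofReal ((H w - ∫ x, H (x, w.2) ∂μ) ^ 2) :=
          ((hH.sub (hbm.comp measurable_snd)).pow_const 2).ennreal_ofReal
        exact this.aemeasurable
    _ = _ := by
        rw [add_comm]
        simp_rw [evariance_eq_lintegral_ofReal]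

/-- The **Efron–Stein inequality**, where `G j` is any function of the coordinates other than `j`. -/
theorem evariance_pi_le_sum {α : Type*} [MeasurableSpace α] (μ : Measure α)
    [IsProbabilityMeasure μ] {n : ℕ} {H : (Fin n → α) → ℝ} (hH : Measurable H) {B : ℝ}
    (hB : ∀ x, |H x| ≤ B) {G : Fin n → (Fin n → α) → ℝ} (hG : ∀ j, Measurable (G j))
    (hGj : ∀ j x a, G j (Function.update x j a) = G j x) :
    evariance H (Measure.pi fun _ => μ) ≤
      ∑ j, ∫⁻ x, ENNReal.ofReal ((H x - G j x) ^ 2) ∂(Measure.pi fun _ => μ) := by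
  induction n with
  | zero =>
    have : H = fun _ => H default := by
      ext x
      rw [Subsingleton.elim x default]
    rw [this, evariance_eq_lintegral_ofReal]
    simp
  | succ n ih =>
    have hmp := (measurePreserving_piFinSuccAbove (fun _ : Fin (n + 1) => μ) 0).symm
    have hsymm : ∀ w : α × (Fin n → α),
        (MeasurableEquiv.piFinSuccAbove (fun _ : Fin (n + 1) => α) 0).symm w =
          Fin.cons w.1 w.2 := fun w => by
      simp [MeasurableEquiv.piFinSuccAbove, Fin.consEquiv]
    have hcons : Measurable fun w : α × (Fin n → α) => (Fin.cons w.1 w.2 : Fin (n + 1) → α) := by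
      have := (MeasurableEquiv.piFinSuccAbove (fun _ : Fin (n + 1) => α) 0).symm.measurable
      simpa only [funext hsymm] using this
    have hlint : ∀ φ : (Fin (n + 1) → α) → ℝ≥0∞, Measurable φ →
        ∫⁻ x, φ x ∂(Measure.pi fun _ => μ) =
          ∫⁻ w, φ (Fin.cons w.1 w.2) ∂(μ.prod (Measure.pi fun _ => μ)) := by
      intro φ hφ
      rw [← hmp.lintegral_comp hφ]
      simp_rw [hsymm]
    have hint : ∫ x, H x ∂(Measure.pi fun _ => μ) =
        ∫ w, H (Fin.cons w.1 w.2) ∂(μ.prod (Measure.pi fun _ => μ)) := by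
      rw [← hmp.integral_comp']
      simp_rw [hsymm]
    have hHc : Measurable fun w : α × (Fin n → α) => H (Fin.cons w.1 w.2) := hH.comp hcons
    have hvar : evariance H (Measure.pi fun _ => μ) =
        evariance (fun w : α × (Fin n → α) => H (Fin.cons w.1 w.2))
          (μ.prod (Measure.pi fun _ => μ)) := by
      rw [evariance_eq_lintegral_ofReal, evariance_eq_lintegral_ofReal, ← hint,
        hlint _ (by fun_prop)]
    rw [hvar, Fin.sum_univ_succ]
    refine (evariance_prod_le _ _ hHc fun w => hB _).trans ?_
    have hGc : ∀ j, Measurable fun w : α × (Fin n → α) =>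
        ENNReal.ofReal ((H (Fin.cons w.1 w.2) - G j (Fin.cons w.1 w.2)) ^ 2) := fun j => by
      have := (hG j).comp hcons
      simp only [Function.comp_def] at this
      fun_prop
    gcongr ?_ + ?_
    · rw [hlint _ (by have := hG 0; fun_prop), lintegral_prod_symm _ (hGc 0).aemeasurable]
      refine lintegral_mono fun y => ?_
      by_cases hα : Nonempty α
      · obtain ⟨a⟩ := hα
        -- With the other coordinates fixed, `G 0` is a constant, and the variance is the least mean
        -- squared deviation from a constant.
        have h0 : ∀ x, G 0 (Fin.cons x y) = G 0 (Fin.cons a y) := fun x => by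
          rw [← hGj 0 (Fin.cons a y) x, Fin.update_cons_zero]
        simp_rw [h0]
        exact evariance_le_lintegral_sub_sq μ
          (memLp_of_abs_le (hHc.comp measurable_prodMk_right) (fun x => hB _) 2) _
      · rw [not_nonempty_iff] at hα
        simp [evariance_eq_lintegral_ofReal]
    · have : ∀ x : α, evariance (fun y => H (Fin.cons x y)) (Measure.pi fun _ => μ) ≤
          ∑ j : Fin n, ∫⁻ y, ENNReal.ofReal
            ((H (Fin.cons x y) - G j.succ (Fin.cons x y)) ^ 2) ∂(Measure.pi fun _ => μ) := by
        intro x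
        refine ih (H := fun y => H (Fin.cons x y)) (hHc.comp measurable_prodMk_left)
          (fun y => hB _) (G := fun j y => G j.succ (Fin.cons x y))
          (fun j => (hG j.succ).comp (hcons.comp measurable_prodMk_left)) fun j y a => ?_
        rw [← hGj j.succ (Fin.cons x y) a, Fin.cons_update]
      refine (lintegral_mono this).trans ?_
      rw [lintegral_finsetSum' _ fun j _ => ?_]
      · refine (Finset.sum_congr rfl fun j _ => ?_).le
        rw [hlint _ (by have := hG j.succ; fun_prop), lintegral_prod _ (hGc j.succ).aemeasurable]
      · exact (hGc j.succ).lintegral_prod_right'.aemeasurable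

end EfronStein

/-! ### Maximal coupling. -/

section MaximalCoupling

lemma abs_measureReal_sub_le_tvDist {α : Type*} [MeasurableSpace α] (P Q : Measure α)
    [IsProbabilityMeasure P] [IsProbabilityMeasure Q] {A : Set α} (hA : MeasurableSet A) :
    |P.real A - Q.real A| ≤ tvDist P Q := by
  refine le_ciSup (f := fun A : {A : Set α // MeasurableSet A} => |P.real A - Q.real A|)
    ⟨1, ?_⟩ ⟨A, hA⟩
  rintro _ ⟨B, rfl⟩
  have h1 : P.real B ≤ 1 := measureReal_le_one
  have h2 : Q.real B ≤ 1 := measureReal_le_one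
  have h3 : 0 ≤ P.real B := measureReal_nonneg
  have h4 : 0 ≤ Q.real B := measureReal_nonneg
  exact abs_le.2 ⟨by linarith, by linarith⟩

/-- Two probability measures with densities have a coupling that is off the diagonal with
probability at most their total variation distance. -/
theorem exists_coupling_le_tvDist {α : Type*} [MeasurableSpace α] [MeasurableEq α]
    (vol : Measure α) [SigmaFinite vol] {f g : α → ℝ≥0∞} (hf : Measurable f) (hg : Measurable g)
    {P Q : Measure α} [IsProbabilityMeasure P] [IsProbabilityMeasure Q]
    (hP : P = vol.withDensity f) (hQ : Q = vol.withDensity g) :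
    ∃ π : Measure (α × α), IsCoupling π P Q ∧
      π {w | w.1 ≠ w.2} ≤ ENNReal.ofReal (tvDist P Q) := by
  set ν := vol.withDensity fun x => min (f x) (g x) with hν
  set h₁ := vol.withDensity fun x => f x - g x with hh₁
  set h₂ := vol.withDensity fun x => g x - f x with hh₂
  have hP' : ν + h₁ = P := by
    rw [hP, hν, hh₁, ← withDensity_add_left (hf.min hg)]
    congr 1
    ext x
    rcases le_total (f x) (g x) with h | h
    · simp [h, tsub_eq_zero_of_le h]
    · simp [h]
  have hQ' : ν + h₂ = Q := by
    rw [hQ, hν, hh₂, ← withDensity_add_left (hf.min hg)]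
    congr 1
    ext x
    rcases le_total (f x) (g x) with h | h
    · simp [h]
    · simp [h, tsub_eq_zero_of_le h]
  have hνP : ν ≤ P := hP' ▸ Measure.le_add_right le_rfl
  have hh₁P : h₁ ≤ P := hP' ▸ Measure.le_add_left le_rfl
  have hh₂Q : h₂ ≤ Q := hQ' ▸ Measure.le_add_left le_rfl
  have : IsFiniteMeasure ν := isFiniteMeasure_of_le P hνP
  have : IsFiniteMeasure h₁ := isFiniteMeasure_of_le P hh₁P
  have : IsFiniteMeasure h₂ := isFiniteMeasure_of_le Q hh₂Q
  have hmass : h₂ Set.univ = h₁ Set.univ := by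
    have e1 : ν Set.univ + h₁ Set.univ = 1 := by
      rw [← Measure.add_apply, hP', measure_univ]
    have e2 : ν Set.univ + h₂ Set.univ = 1 := by
      rw [← Measure.add_apply, hQ', measure_univ]
    rw [← e1] at e2
    exact (ENNReal.add_right_inj (measure_ne_top ν _)).1 e2
  set δ := h₁ Set.univ with hδ
  have hδtop : δ ≠ ∞ := measure_ne_top _ _
  have hδtv : δ ≤ ENNReal.ofReal (tvDist P Q) := by
    -- On this set the excess of `f` over `g` has its full mass and the opposite excess has none, so
    -- it witnesses `δ ≤ tvDist P Q`.
    have hA : MeasurableSet {x | g x < f x} := measurableSet_lt hg hf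
    have z1 : h₁ {x | g x < f x}ᶜ = 0 := by
      rw [hh₁, withDensity_apply _ hA.compl, lintegral_eq_zero_iff (by fun_prop)]
      filter_upwards [ae_restrict_mem hA.compl] with x hx
      exact tsub_eq_zero_of_le (not_lt.1 hx)
    have z2 : h₂ {x | g x < f x} = 0 := by
      rw [hh₂, withDensity_apply _ hA, lintegral_eq_zero_iff (by fun_prop)]
      filter_upwards [ae_restrict_mem hA] with x hx
      exact tsub_eq_zero_of_le (le_of_lt hx)
    have e1 : δ = h₁ {x | g x < f x} := by
      rw [hδ, ← measure_add_measure_compl hA, z1, add_zero]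
    have e2 : P.real {x | g x < f x} - Q.real {x | g x < f x} = δ.toReal := by
      rw [← hP', ← hQ', measureReal_add_apply, measureReal_add_apply, measureReal_def h₂, z2,
        measureReal_def h₁, ← e1]
      simp
    rw [← ENNReal.ofReal_toReal hδtop, ← e2]
    exact ENNReal.ofReal_le_ofReal
      ((le_abs_self _).trans (abs_measureReal_sub_le_tvDist P Q hA))
  have hdiag : Measurable fun x : α => (x, x) := by fun_prop
  -- The common part is put on the diagonal, and the two excesses, both of mass `δ`, are made
  -- independent. If `δ = 0`, then `δ⁻¹ = ∞` multiplies the zero measure, which is harmless.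
  refine ⟨ν.map (fun x => (x, x)) + δ⁻¹ • h₁.prod h₂, ⟨?_, ?_⟩, ?_⟩
  · rw [Measure.map_add _ _ measurable_fst, Measure.map_map measurable_fst hdiag,
      Measure.map_smul, Measure.map_fst_prod, hmass]
    by_cases h0 : δ = 0
    · have : h₁ = 0 := Measure.measure_univ_eq_zero.1 h0
      rw [← hP', this]
      simp [Function.comp_def]
    · rw [smul_smul, ENNReal.inv_mul_cancel h0 hδtop, one_smul, ← hP']
      simp [Function.comp_def]
  · rw [Measure.map_add _ _ measurable_snd, Measure.map_map measurable_snd hdiag,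
      Measure.map_smul, Measure.map_snd_prod, ← hδ]
    by_cases h0 : δ = 0
    · have : h₂ = 0 := Measure.measure_univ_eq_zero.1 (hmass.trans h0)
      rw [← hQ', this]
      simp [Function.comp_def]
    · rw [smul_smul, ENNReal.inv_mul_cancel h0 hδtop, one_smul, ← hQ']
      simp [Function.comp_def]
  · have hne : MeasurableSet {w : α × α | w.1 ≠ w.2} :=
      (measurableSet_eq_fun measurable_fst measurable_snd).compl
    rw [Measure.add_apply, Measure.map_apply hdiag hne, Measure.smul_apply, smul_eq_mul]
    have : (fun x : α => (x, x)) ⁻¹' {w : α × α | w.1 ≠ w.2} = ∅ := by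
      ext x
      simp
    rw [this, measure_empty, zero_add]
    refine le_trans ?_ hδtv
    calc δ⁻¹ * (h₁.prod h₂) {w | w.1 ≠ w.2} ≤ δ⁻¹ * (h₁.prod h₂) Set.univ := by
          gcongr
          exact Set.subset_univ _
      _ = δ⁻¹ * (δ * δ) := by
          rw [← Set.univ_prod_univ, Measure.prod_prod, hmass]
      _ ≤ δ := by
          rw [← mul_assoc]
          exact mul_le_of_le_one_left' (ENNReal.inv_mul_le_one δ)

end MaximalCoupling

/-! ### Moments of binomial counts, and Jensen's inequality. -/

section Moments

/-- The number of coordinates of `w` in `B`. -/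
def hits {α : Type*} {m : ℕ} (B : Set α) (w : Fin m → α) : ℝ :=
  ∑ i, B.indicator (fun _ => (1 : ℝ)) (w i)

lemma hits_nonneg {α : Type*} {m : ℕ} (B : Set α) (w : Fin m → α) : 0 ≤ hits B w :=
  Finset.sum_nonneg fun _ _ => Set.indicator_nonneg (fun _ _ => zero_le_one) _

/-- Independence gives (1 + π(B)(e^t - 1))^m, which is at most the Poisson generating function of
the same mean. -/
lemma lintegral_exp_hits_le {α : Type*} [MeasurableSpace α] (π : Measure α)
    [IsProbabilityMeasure π] (m : ℕ) {B : Set α} (hB : MeasurableSet B) (t : ℝ) :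
    ∫⁻ w, ENNReal.ofReal (Real.exp (t * hits B w)) ∂(Measure.pi fun _ : Fin m => π) ≤
      ENNReal.ofReal (Real.exp (m * π.real B * (Real.exp t - 1))) := by
  have h1 : ∀ w : Fin m → α, Real.exp (t * hits B w) =
      ∏ i, (1 + B.indicator (fun _ => Real.exp t - 1) (w i)) := by
    intro w
    rw [hits, Finset.mul_sum, Real.exp_sum]
    refine Finset.prod_congr rfl fun i _ => ?_
    by_cases h : w i ∈ B
    · simp [h]
    · simp [h]
  have hi : Integrable (fun y => 1 + B.indicator (fun _ => Real.exp t - 1) y) π :=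
    (integrable_const _).add ((integrable_const _).indicator hB)
  have h2 : ∫ y, (1 + B.indicator (fun _ => Real.exp t - 1) y) ∂π =
      1 + π.real B * (Real.exp t - 1) := by
    rw [integral_add (integrable_const _) ((integrable_const _).indicator hB),
      integral_indicator_const _ hB]
    simp
  have h3 : Integrable (fun w : Fin m → α => ∏ i,
      (1 + B.indicator (fun _ => Real.exp t - 1) (w i))) (Measure.pi fun _ => π) :=
    Integrable.fintype_prod (fun _ => hi)
  simp_rw [h1]
  rw [← ofReal_integral_eq_lintegral_ofReal h3 (ae_of_all _ fun w =>
    (Real.exp_pos _).le.trans_eq (h1 w))]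
  refine ENNReal.ofReal_le_ofReal ?_
  rw [integral_fintype_prod_eq_pow (ι := Fin m)
    (f := fun y => 1 + B.indicator (fun _ => Real.exp t - 1) y), h2, Fintype.card_fin, mul_assoc,
    Real.exp_nat_mul]
  have h4 : 0 ≤ 1 + π.real B * (Real.exp t - 1) := by
    have : π.real B ≤ 1 := measureReal_le_one
    have h0 : 0 ≤ π.real B := measureReal_nonneg
    nlinarith [Real.exp_pos t]
  gcongr
  linarith [Real.add_one_le_exp (π.real B * (Real.exp t - 1))]

/-- Raise y ≤ (1+s) exp(y/(1+s)) to the power `s` and use s/(1+s) ≤ 1. Dividing by `1 + s` rather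
than `s` admits `s = 0`. -/
lemma rpow_le_mul_exp {s y : ℝ} (hs : 0 ≤ s) (hy : 0 ≤ y) :
    y ^ s ≤ (1 + s) ^ s * Real.exp y := by
  have h1 : y ≤ (1 + s) * Real.exp (y / (1 + s)) := by
    have := Real.add_one_le_exp (y / (1 + s))
    have h2 : y = (1 + s) * (y / (1 + s)) := by field_simp
    calc y = (1 + s) * (y / (1 + s)) := h2
      _ ≤ _ := by gcongr; linarith
  calc y ^ s ≤ ((1 + s) * Real.exp (y / (1 + s))) ^ s := by gcongr
    _ = (1 + s) ^ s * Real.exp (y / (1 + s) * s) := by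
      rw [Real.mul_rpow (by positivity) (by positivity), Real.exp_mul]
    _ ≤ _ := by
      gcongr
      rw [div_mul_eq_mul_div, div_le_iff₀ (by positivity)]
      nlinarith

/-- Moments of binomial counts, of any real order. -/
lemma lintegral_hits_rpow_le {α : Type*} [MeasurableSpace α] (π : Measure α)
    [IsProbabilityMeasure π] (m : ℕ) {B : Set α} (hB : MeasurableSet B) {s : ℝ} (hs : 0 ≤ s)
    {l : ℝ} (hl : 1 ≤ l) (hml : m * π.real B ≤ l) :
    ∫⁻ w, ENNReal.ofReal ((1 + hits B w) ^ s) ∂(Measure.pi fun _ : Fin m => π) ≤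
      ENNReal.ofReal ((1 + s) ^ s * Real.exp 3 * l ^ s) := by
  have hl0 : 0 < l := by linarith
  have h1 : ∀ w : Fin m → α, (1 + hits B w) ^ s ≤
      (1 + s) ^ s * Real.exp 1 * l ^ s * Real.exp (1 / l * hits B w) := by
    intro w
    have hn := hits_nonneg B w
    -- The count is measured in units of `l`, so the exponential moment is taken at `1 / l`, where
    -- the generating function is at most `exp 2`. The summand `1` costs a factor `exp 1`; together
    -- they make the `exp 3` of the statement.
    have h2 := rpow_le_mul_exp hs (y := (1 + hits B w) / l) (by positivity)
    rw [Real.div_rpow (by positivity) hl0.le, div_le_iff₀ (by positivity)] at h2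
    refine h2.trans ?_
    have h3 : Real.exp ((1 + hits B w) / l) ≤ Real.exp 1 * Real.exp (1 / l * hits B w) := by
      rw [← Real.exp_add]
      gcongr
      rw [add_div, one_div_mul_eq_div]
      gcongr
      rw [div_le_one hl0]
      exact hl
    calc (1 + s) ^ s * Real.exp ((1 + hits B w) / l) * l ^ s
        ≤ (1 + s) ^ s * (Real.exp 1 * Real.exp (1 / l * hits B w)) * l ^ s := by gcongr
      _ = _ := by ring
  calc ∫⁻ w, ENNReal.ofReal ((1 + hits B w) ^ s) ∂(Measure.pi fun _ : Fin m => π)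
      ≤ ∫⁻ w, ENNReal.ofReal ((1 + s) ^ s * Real.exp 1 * l ^ s) *
          ENNReal.ofReal (Real.exp (1 / l * hits B w)) ∂(Measure.pi fun _ : Fin m => π) := by
        refine lintegral_mono fun w => ?_
        rw [← ENNReal.ofReal_mul (by positivity)]
        exact ENNReal.ofReal_le_ofReal (h1 w)
    _ ≤ ENNReal.ofReal ((1 + s) ^ s * Real.exp 1 * l ^ s) *
          ENNReal.ofReal (Real.exp (m * π.real B * (Real.exp (1 / l) - 1))) := by
        rw [lintegral_const_mul' _ _ ENNReal.ofReal_ne_top]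
        gcongr
        exact lintegral_exp_hits_le π m hB _
    _ ≤ ENNReal.ofReal ((1 + s) ^ s * Real.exp 1 * l ^ s) * ENNReal.ofReal (Real.exp 2) := by
        gcongr
        have h5 : |1 / l| ≤ 1 := by
          rw [abs_of_pos (by positivity), div_le_one hl0]
          exact hl
        have h6 := (abs_le.1 (Real.abs_exp_sub_one_le h5)).2
        have h7 : 0 ≤ Real.exp (1 / l) - 1 := by
          linarith [Real.add_one_le_exp (1 / l), (by positivity : 0 < 1 / l)]
        rw [abs_of_pos (by positivity)] at h6
        calc m * π.real B * (Real.exp (1 / l) - 1) ≤ l * (2 * (1 / l)) := by gcongr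
          _ = 2 := by field_simp
    _ = _ := by
        rw [← ENNReal.ofReal_mul (by positivity)]
        congr 1
        rw [show (3 : ℝ) = 1 + 2 by norm_num, Real.exp_add]
        ring

/-- Jensen's inequality for a finite measure. -/
lemma lintegral_le_rpow_mul_rpow {α : Type*} [MeasurableSpace α] (κ : Measure α) {g : α → ℝ≥0∞}
    (hg : AEMeasurable g κ) {s : ℝ} (hs : 1 ≤ s) :
    ∫⁻ x, g x ∂κ ≤ (∫⁻ x, g x ^ s ∂κ) ^ (1 / s) * κ Set.univ ^ (1 - 1 / s) := by
  have hs0 : 0 < s := by linarith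
  have h := ENNReal.lintegral_mul_norm_pow_le (μ := κ) (f := fun x => g x ^ s)
    (g := fun _ => (1 : ℝ≥0∞)) (hg.pow_const s) aemeasurable_const (p := 1 / s) (q := 1 - 1 / s)
    (by positivity) (by rw [sub_nonneg, div_le_one hs0]; exact hs) (by ring)
  simp only [ENNReal.one_rpow, mul_one, lintegral_const, one_mul] at h
  refine le_trans (le_of_eq (lintegral_congr fun x => ?_)) h
  rw [← ENNReal.rpow_mul, mul_one_div_cancel hs0.ne', ENNReal.rpow_one]

lemma lintegral_rpow_le {α : Type*} [MeasurableSpace α] (κ : Measure α) {g : α → ℝ≥0∞}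
    (hg : AEMeasurable g κ) {s : ℝ} (hs : 1 ≤ s) :
    (∫⁻ x, g x ∂κ) ^ s ≤ κ Set.univ ^ (s - 1) * ∫⁻ x, g x ^ s ∂κ := by
  have hs0 : 0 < s := by linarith
  calc (∫⁻ x, g x ∂κ) ^ s
      ≤ ((∫⁻ x, g x ^ s ∂κ) ^ (1 / s) * κ Set.univ ^ (1 - 1 / s)) ^ s := by
        gcongr
        exact lintegral_le_rpow_mul_rpow κ hg hs
    _ = _ := by
        rw [ENNReal.mul_rpow_of_nonneg _ _ hs0.le, ← ENNReal.rpow_mul, ← ENNReal.rpow_mul,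
          one_div_mul_cancel hs0.ne', ENNReal.rpow_one, mul_comm]
        congr 2
        field_simp

end Moments

/-! ### Expected numbers of neighbours, and their moments. -/

section Intensity

variable {d : ℕ}

/-- The pairs of points that are at most `ρ` apart after scaling by `n^{1/d}`. -/
def nearSet (d n : ℕ) (ρ : ℝ) : Set (E d × E d) :=
  {w | dist ((n : ℝ) ^ ((d : ℝ)⁻¹) • w.1) ((n : ℝ) ^ ((d : ℝ)⁻¹) • w.2) ≤ ρ}

lemma measurableSet_nearSet (d n : ℕ) (ρ : ℝ) : MeasurableSet (nearSet d n ρ) := by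
  refine measurableSet_le ?_ measurable_const
  fun_prop

/-- The points near `x`. -/
def nbhd (n : ℕ) (ρ : ℝ) (x : E d) : Set (E d) := {y | (x, y) ∈ nearSet d n ρ}

lemma measurableSet_nbhd (n : ℕ) (ρ : ℝ) (x : E d) : MeasurableSet (nbhd n ρ x) :=
  measurable_prodMk_left (measurableSet_nearSet d n ρ)

lemma mem_nbhd_comm {n : ℕ} {ρ : ℝ} {x y : E d} : y ∈ nbhd n ρ x ↔ x ∈ nbhd n ρ y := by
  simp [nbhd, nearSet, dist_comm]

/-- The expected number of points near `x` in a sample of size `n` from `P`. -/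
def intensity (P : Measure (E d)) (n : ℕ) (ρ : ℝ) (x : E d) : ℝ≥0∞ := n * P (nbhd n ρ x)

lemma measurable_intensity (P : Measure (E d)) [SFinite P] (n : ℕ) (ρ : ℝ) :
    Measurable (intensity P n ρ) :=
  (measurable_measure_prodMk_left (measurableSet_nearSet d n ρ)).const_mul _

/-- The Lebesgue measure of the ball of radius `ρ`. -/
def ballVol (d : ℕ) (ρ : ℝ) : ℝ≥0∞ := volume (Metric.closedBall (0 : E d) ρ)

lemma ballVol_ne_top (d : ℕ) (ρ : ℝ) : ballVol d ρ ≠ ∞ := measure_closedBall_lt_top.ne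

/-- Scaling by n^{1/d} multiplies volume by `n`, which cancels the factor `n` in the intensity. This
is the source of uniformity in `n`. -/
lemma intensity_volume (hd : 0 < d) {n : ℕ} (hn : 0 < n) (ρ : ℝ) (x : E d) :
    intensity volume n ρ x = ballVol d ρ := by
  have hn' : (0 : ℝ) < n := by exact_mod_cast hn
  have hc : (0 : ℝ) < (n : ℝ) ^ ((d : ℝ)⁻¹) := by positivity
  have hset : nbhd n ρ x = (fun y : E d => (n : ℝ) ^ ((d : ℝ)⁻¹) • y) ⁻¹'
      Metric.closedBall ((n : ℝ) ^ ((d : ℝ)⁻¹) • x) ρ := by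
    ext y
    simp [nbhd, nearSet, dist_comm]
  rw [intensity, hset, Measure.addHaar_preimage_smul _ hc.ne', finrank_euclideanSpace_fin,
    ← Real.rpow_natCast, ← Real.rpow_mul hn'.le, inv_mul_cancel₀ (by positivity), Real.rpow_one,
    abs_of_pos (by positivity), Measure.addHaar_closedBall_center, ← mul_assoc,
    ENNReal.ofReal_inv_of_pos hn', ENNReal.ofReal_natCast,
    ENNReal.mul_inv_cancel (by exact_mod_cast hn.ne') (ENNReal.natCast_ne_top n), one_mul, ballVol]

/-- A Young-type inequality: Jensen on the neighbourhood, whose mass under `n` times volume is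
`ballVol d ρ`, and then Tonelli with the symmetry of nearness. -/
lemma lintegral_intensity_rpow_le_volume (hd : 0 < d) {n : ℕ} (hn : 0 < n) (ρ : ℝ)
    {g : E d → ℝ≥0∞} (hg : Measurable g) {p : ℝ} (hp : 1 ≤ p) :
    ∫⁻ x, intensity (volume.withDensity g) n ρ x ^ p ≤ ballVol d ρ ^ p * ∫⁻ x, g x ^ p := by
  have h1 : ∀ x, intensity (volume.withDensity g) n ρ x ^ p ≤
      ballVol d ρ ^ (p - 1) * (n * ∫⁻ y in nbhd n ρ x, g y ^ p) := by
    intro x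
    have := lintegral_rpow_le ((n : ℝ≥0∞) • volume.restrict (nbhd n ρ x)) hg.aemeasurable hp
    rw [lintegral_smul_measure, lintegral_smul_measure, smul_eq_mul, smul_eq_mul,
      Measure.smul_apply, Measure.restrict_apply_univ, smul_eq_mul] at this
    rw [intensity, withDensity_apply _ (measurableSet_nbhd n ρ x)]
    refine this.trans (le_of_eq ?_)
    congr 2
    exact intensity_volume hd hn ρ x
  have hmeas : Measurable fun w : E d × E d =>
      (nearSet d n ρ).indicator (fun w => g w.2 ^ p) w :=
    ((hg.comp measurable_snd).pow_const p).indicator (measurableSet_nearSet d n ρ)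
  have hind : ∀ x y, (nbhd n ρ x).indicator (fun y => g y ^ p) y =
      (nearSet d n ρ).indicator (fun w => g w.2 ^ p) (x, y) := fun x y => rfl
  have hind2 : ∀ x y, (nearSet d n ρ).indicator (fun w => g w.2 ^ p) (x, y) =
      (nbhd n ρ y).indicator (fun _ => g y ^ p) x := fun x y => by
    rw [← hind]
    by_cases h : y ∈ nbhd n ρ x
    · rw [Set.indicator_of_mem h, Set.indicator_of_mem (mem_nbhd_comm.1 h)]
    · rw [Set.indicator_of_notMem h, Set.indicator_of_notMem (fun h' => h (mem_nbhd_comm.1 h'))]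
  calc ∫⁻ x, intensity (volume.withDensity g) n ρ x ^ p
      ≤ ∫⁻ x, ballVol d ρ ^ (p - 1) * (n * ∫⁻ y in nbhd n ρ x, g y ^ p) := lintegral_mono h1
    _ = ballVol d ρ ^ (p - 1) * (n * ∫⁻ x, ∫⁻ y in nbhd n ρ x, g y ^ p) := by
        rw [lintegral_const_mul' _ _ (ENNReal.rpow_ne_top_of_nonneg (by linarith)
          (ballVol_ne_top d ρ)), lintegral_const_mul' _ _ (ENNReal.natCast_ne_top n)]
    _ = ballVol d ρ ^ (p - 1) * (n * ∫⁻ y, ∫⁻ x, (nbhd n ρ y).indicator (fun _ => g y ^ p) x) := by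
        congr 2
        simp_rw [← lintegral_indicator (measurableSet_nbhd n ρ _), hind]
        rw [lintegral_lintegral_swap hmeas.aemeasurable]
        simp_rw [hind2]
    _ = ballVol d ρ ^ (p - 1) * ∫⁻ y, ballVol d ρ * g y ^ p := by
        congr 1
        rw [← lintegral_const_mul' _ _ (ENNReal.natCast_ne_top n)]
        refine lintegral_congr fun y => ?_
        rw [lintegral_indicator_const (measurableSet_nbhd n ρ y), ← intensity_volume hd hn ρ y,
          intensity]
        ring
    _ = ballVol d ρ ^ p * ∫⁻ x, g x ^ p := by
        rw [lintegral_const_mul' _ _ (ballVol_ne_top d ρ), ← mul_assoc]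
        congr 1
        nth_rewrite 2 [← ENNReal.rpow_one (ballVol d ρ)]
        rw [← ENNReal.rpow_add_of_nonneg _ _ (by linarith) zero_le_one, sub_add_cancel]

/-- The moment of order `s` of the expected number of neighbours of a random point is controlled by
the `L^{s+1}` norm of the density. -/
lemma lintegral_intensity_rpow_le (hd : 0 < d) {n : ℕ} (hn : 0 < n) (ρ : ℝ)
    {g : E d → ℝ≥0∞} (hg : Measurable g) {s : ℝ} (hs : 0 ≤ s) :
    ∫⁻ x, intensity (volume.withDensity g) n ρ x ^ s ∂(volume.withDensity g) ≤
      (1 + ballVol d ρ ^ (s + 1)) * ∫⁻ x, g x ^ (s + 1) := by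
  have hlam := measurable_intensity (volume.withDensity g) n ρ
  rw [lintegral_withDensity_eq_lintegral_mul _ hg (hlam.pow_const s)]
  -- A product of a factor and an `s`-th power is at most the `(s + 1)`-th power of the larger of
  -- the two bases.
  have : ∀ x, (g * fun x => intensity (volume.withDensity g) n ρ x ^ s) x ≤
      g x ^ (s + 1) + intensity (volume.withDensity g) n ρ x ^ (s + 1) := by
    intro x
    have hsp : ∀ a : ℝ≥0∞, a * a ^ s = a ^ (s + 1) := fun a => by
      nth_rewrite 1 [← ENNReal.rpow_one a]
      rw [← ENNReal.rpow_add_of_nonneg _ _ zero_le_one hs, add_comm]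
    rw [Pi.mul_apply]
    rcases le_total (g x) (intensity (volume.withDensity g) n ρ x) with h | h
    · refine le_trans ?_ le_add_self
      rw [← hsp]
      gcongr
    · refine le_trans ?_ le_self_add
      rw [← hsp]
      gcongr
  refine (lintegral_mono this).trans ?_
  rw [lintegral_add_left (hg.pow_const _), add_mul, one_mul]
  gcongr
  exact lintegral_intensity_rpow_le_volume hd hn ρ hg (by linarith)

lemma intensity_le_of_ae_le (hd : 0 < d) {n : ℕ} (hn : 0 < n) (ρ : ℝ)
    {g : E d → ℝ≥0∞} {M : ℝ≥0∞} (hgM : ∀ᵐ x, g x ≤ M) (x : E d) :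
    intensity (volume.withDensity g) n ρ x ≤ M * ballVol d ρ := by
  rw [intensity, withDensity_apply _ (measurableSet_nbhd n ρ x), ← intensity_volume hd hn ρ x,
    intensity]
  calc n * ∫⁻ y in nbhd n ρ x, g y ≤ n * ∫⁻ y in nbhd n ρ x, M := by
        gcongr 1
        exact lintegral_mono_ae (ae_restrict_of_ae hgM)
    _ = _ := by
        rw [lintegral_const, Measure.restrict_apply_univ]
        ring

end Intensity

/-! ### Coupled pairs: the discrepancy event and the neighbour counts. -/

section PairSamples

variable {d : ℕ}

/-- The event that the pair `z` or one of the pairs near it is off the diagonal. -/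
def discrepancySet (d n : ℕ) (ρ : ℝ) (m : ℕ) : Set ((E d × E d) × (Fin m → E d × E d)) :=
  {v | v.1.1 ≠ v.1.2} ∪
    ((⋃ i, {v | (v.2 i).1 ≠ (v.2 i).2 ∧ (v.1.1, (v.2 i).1) ∈ nearSet d n ρ}) ∪
      ⋃ i, {v | (v.2 i).1 ≠ (v.2 i).2 ∧ (v.1.2, (v.2 i).2) ∈ nearSet d n ρ})

lemma measurableSet_offDiag (d : ℕ) : MeasurableSet {w : E d × E d | w.1 ≠ w.2} :=
  (measurableSet_eq_fun measurable_fst measurable_snd).compl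

lemma measurableSet_offDiag_near {n m : ℕ} {ρ : ℝ} {e : E d × E d → E d} (he : Measurable e)
    (i : Fin m) :
    MeasurableSet {v : (E d × E d) × (Fin m → E d × E d) |
      (v.2 i).1 ≠ (v.2 i).2 ∧ (e v.1, e (v.2 i)) ∈ nearSet d n ρ} := by
  have hi : Measurable fun v : (E d × E d) × (Fin m → E d × E d) => v.2 i := by fun_prop
  exact (hi (measurableSet_offDiag d)).inter
    (((he.comp measurable_fst).prodMk (he.comp hi)) (measurableSet_nearSet d n ρ))

lemma measurableSet_discrepancySet (d n : ℕ) (ρ : ℝ) (m : ℕ) :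
    MeasurableSet (discrepancySet d n ρ m) :=
  (measurable_fst (measurableSet_offDiag d)).union
    ((MeasurableSet.iUnion fun i => measurableSet_offDiag_near measurable_fst i).union
      (MeasurableSet.iUnion fun i => measurableSet_offDiag_near measurable_snd i))

/-- The first pair is independent of the `i`-th and is integrated out, so only its marginal under
`e` matters. By symmetry of nearness, the mass of a neighbourhood of the `i`-th point remains. -/
lemma measure_offDiag_near {π : Measure (E d × E d)} [IsProbabilityMeasure π] {P : Measure (E d)}
    {e : E d × E d → E d} (he : Measurable e) (hP : π.map e = P) {n m : ℕ} (ρ : ℝ) (i : Fin m) :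
    (π.prod (Measure.pi fun _ : Fin m => π))
      {v | (v.2 i).1 ≠ (v.2 i).2 ∧ (e v.1, e (v.2 i)) ∈ nearSet d n ρ} =
      ∫⁻ w in {w | w.1 ≠ w.2}, P (nbhd n ρ (e w)) ∂π := by
  set T : Set ((E d × E d) × (E d × E d)) :=
    {u | u.2.1 ≠ u.2.2 ∧ (e u.1, e u.2) ∈ nearSet d n ρ} with hT
  have hTm : MeasurableSet T := (measurable_snd (measurableSet_offDiag d)).inter
    (((he.comp measurable_fst).prodMk (he.comp measurable_snd)) (measurableSet_nearSet d n ρ))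
  have hmp : MeasurePreserving (Prod.map id (Function.eval i))
      (π.prod (Measure.pi fun _ : Fin m => π)) (π.prod π) :=
    (MeasurePreserving.id π).prod (measurePreserving_eval _ i)
  have h1 := hmp.measure_preimage hTm.nullMeasurableSet
  have h2 : Prod.map id (Function.eval i) ⁻¹' T =
      {v : (E d × E d) × (Fin m → E d × E d) |
        (v.2 i).1 ≠ (v.2 i).2 ∧ (e v.1, e (v.2 i)) ∈ nearSet d n ρ} := rfl
  rw [← h2, h1, Measure.prod_apply_symm hTm, ← lintegral_indicator (measurableSet_offDiag d)]
  refine lintegral_congr fun w => ?_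
  by_cases hw : w.1 ≠ w.2
  · rw [Set.indicator_of_mem (by exact hw), ← hP, Measure.map_apply he (measurableSet_nbhd n ρ _)]
    congr 1
    ext z
    simp only [hT, Set.mem_preimage, Set.mem_ofPred_eq, mem_nbhd_comm (x := e w)]
    exact and_iff_right hw
  · rw [Set.indicator_of_notMem (by exact hw)]
    have : (fun x => (x, w)) ⁻¹' T = ∅ := by
      ext z
      simp only [hT, Set.mem_preimage, Set.mem_ofPred_eq, Set.mem_empty_iff_false, iff_false]
      exact fun h => hw h.1
    rw [this, measure_empty]

lemma measure_iUnion_offDiag_near_le {π : Measure (E d × E d)} [IsProbabilityMeasure π]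
    {P : Measure (E d)} {e : E d × E d → E d} (he : Measurable e) (hP : π.map e = P) {n m : ℕ}
    (hmn : m ≤ n) (ρ : ℝ) :
    (π.prod (Measure.pi fun _ : Fin m => π))
      (⋃ i, {v | (v.2 i).1 ≠ (v.2 i).2 ∧ (e v.1, e (v.2 i)) ∈ nearSet d n ρ}) ≤
      ∫⁻ w in {w | w.1 ≠ w.2}, intensity P n ρ (e w) ∂π := by
  refine (measure_iUnion_fintype_le _ _).trans ?_
  simp_rw [measure_offDiag_near he hP ρ]
  rw [Finset.sum_const, Finset.card_univ, Fintype.card_fin, nsmul_eq_mul]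
  simp_rw [intensity]
  rw [lintegral_const_mul' _ _ (ENNReal.natCast_ne_top n)]
  gcongr

lemma measure_discrepancySet_le {π : Measure (E d × E d)} [IsProbabilityMeasure π]
    {P Q : Measure (E d)} (hπ : IsCoupling π P Q) {n m : ℕ} (hmn : m ≤ n) (ρ : ℝ) :
    (π.prod (Measure.pi fun _ : Fin m => π)) (discrepancySet d n ρ m) ≤
      π {w | w.1 ≠ w.2} + (∫⁻ w in {w | w.1 ≠ w.2}, intensity P n ρ w.1 ∂π +
        ∫⁻ w in {w | w.1 ≠ w.2}, intensity Q n ρ w.2 ∂π) := by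
  refine (measure_union_le _ _).trans (add_le_add (le_of_eq ?_) ((measure_union_le _ _).trans
    (add_le_add (measure_iUnion_offDiag_near_le measurable_fst hπ.1 hmn ρ)
      (measure_iUnion_offDiag_near_le measurable_snd hπ.2 hmn ρ))))
  exact measurePreserving_fst.measure_preimage (measurableSet_offDiag d).nullMeasurableSet

/-- Hölder against the indicator of the off-diagonal event. The lost power `1 / s` becomes the
factor (p-2)/(p-1) of the rate when `s = p - 1`. -/
lemma lintegral_intensity_offDiag_le {π : Measure (E d × E d)} {P : Measure (E d)} [SFinite P]
    {e : E d × E d → E d} (he : Measurable e) (hP : π.map e = P) (n : ℕ) (ρ : ℝ) {s : ℝ}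
    (hs : 1 ≤ s) :
    ∫⁻ w in {w | w.1 ≠ w.2}, intensity P n ρ (e w) ∂π ≤
      (∫⁻ x, intensity P n ρ x ^ s ∂P) ^ (1 / s) * π {w | w.1 ≠ w.2} ^ (1 - 1 / s) := by
  have hm := measurable_intensity P n ρ
  refine (lintegral_le_rpow_mul_rpow _ (hm.comp he).aemeasurable hs).trans ?_
  rw [Measure.restrict_apply_univ]
  gcongr
  conv_rhs => rw [← hP, lintegral_map (by rw [hP]; exact hm.pow_const s) he, hP]
  exact setLIntegral_le_lintegral _ _

/-- The number of points of the sample near the point in question. -/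
def neighbors {m : ℕ} (n : ℕ) (ρ : ℝ) (e : E d × E d → E d)
    (v : (E d × E d) × (Fin m → E d × E d)) : ℝ :=
  hits (e ⁻¹' nbhd n ρ (e v.1)) v.2

lemma neighbors_mk {m : ℕ} (n : ℕ) (ρ : ℝ) (e : E d × E d → E d) (z : E d × E d)
    (w : Fin m → E d × E d) : neighbors n ρ e (z, w) = hits (e ⁻¹' nbhd n ρ (e z)) w := rfl

lemma neighbors_nonneg {m : ℕ} (n : ℕ) (ρ : ℝ) (e : E d × E d → E d)
    (v : (E d × E d) × (Fin m → E d × E d)) : 0 ≤ neighbors n ρ e v := hits_nonneg _ _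

lemma measurable_neighbors {m : ℕ} (n : ℕ) (ρ : ℝ) {e : E d × E d → E d} (he : Measurable e) :
    Measurable (neighbors (m := m) n ρ e) := by
  have : neighbors (m := m) n ρ e = fun v => ∑ i : Fin m,
      (nearSet d n ρ).indicator (fun _ => (1 : ℝ)) (e v.1, e (v.2 i)) := rfl
  rw [this]
  refine Finset.measurable_sum _ fun i _ => ?_
  have h1 : Measurable fun v : (E d × E d) × (Fin m → E d × E d) => (e v.1, e (v.2 i)) := by
    fun_prop
  exact (measurable_const.indicator (measurableSet_nearSet d n ρ)).comp h1

lemma ofReal_mul_measureReal_nbhd_le {P : Measure (E d)} [IsProbabilityMeasure P] {n m : ℕ}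
    (hmn : m ≤ n) (ρ : ℝ) (x : E d) :
    m * P.real (nbhd n ρ x) ≤ (intensity P n ρ x).toReal := by
  rw [intensity, ENNReal.toReal_mul, ENNReal.toReal_natCast, measureReal_def]
  gcongr

lemma intensity_ne_top {P : Measure (E d)} [IsFiniteMeasure P] (n : ℕ) (ρ : ℝ) (x : E d) :
    intensity P n ρ x ≠ ∞ :=
  ENNReal.mul_ne_top (ENNReal.natCast_ne_top n) (measure_ne_top _ _)

/-- Given the first pair, the count is binomial with mean at most the intensity at its point; the
real-order moment bound is then integrated over that point. -/
lemma lintegral_neighbors_rpow_le {π : Measure (E d × E d)} [IsProbabilityMeasure π]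
    {P : Measure (E d)} [IsProbabilityMeasure P] {e : E d × E d → E d} (he : Measurable e)
    (hP : π.map e = P) {n m : ℕ} (hmn : m ≤ n) (ρ : ℝ) {s : ℝ} (hs : 0 ≤ s) :
    ∫⁻ v, ENNReal.ofReal ((1 + neighbors n ρ e v) ^ s)
      ∂(π.prod (Measure.pi fun _ : Fin m => π)) ≤
      ENNReal.ofReal ((1 + s) ^ s * Real.exp 3 * 2 ^ s) *
        (1 + ∫⁻ x, intensity P n ρ x ^ s ∂P) := by
  have hm := measurable_intensity P n ρ
  have hN := measurable_neighbors (m := m) n ρ he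
  rw [lintegral_prod _ (by fun_prop)]
  have hreal : ∀ x, π.real (e ⁻¹' nbhd n ρ x) = P.real (nbhd n ρ x) := fun x => by
    rw [← hP, map_measureReal_apply he (measurableSet_nbhd n ρ x)]
  have h1 : ∀ z : E d × E d, ∫⁻ w, ENNReal.ofReal ((1 + neighbors n ρ e (z, w)) ^ s)
      ∂(Measure.pi fun _ : Fin m => π) ≤
        ENNReal.ofReal ((1 + s) ^ s * Real.exp 3 * 2 ^ s) * (1 + intensity P n ρ (e z) ^ s) := by
    intro z
    set l := (intensity P n ρ (e z)).toReal with hl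
    have hl0 : 0 ≤ l := ENNReal.toReal_nonneg
    simp_rw [neighbors_mk]
    have hB : MeasurableSet (e ⁻¹' nbhd n ρ (e z)) := he (measurableSet_nbhd n ρ _)
    -- Taking `1 + l` as the bound for the mean ensures that it is at least `1`.
    refine (lintegral_hits_rpow_le π m hB hs (l := 1 + l) (by linarith) ?_).trans ?_
    · rw [hreal]
      linarith [ofReal_mul_measureReal_nbhd_le (P := P) hmn ρ (e z)]
    · have h2 : (1 + l) ^ s ≤ 2 ^ s * (1 + l ^ s) := by
        have hls : 0 ≤ l ^ s := by positivity
        have h2s : (0 : ℝ) ≤ 2 ^ s := by positivity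
        rcases le_total l 1 with h | h
        · calc (1 + l) ^ s ≤ 2 ^ s := by gcongr; linarith
            _ ≤ _ := by nlinarith
        · calc (1 + l) ^ s ≤ (2 * l) ^ s := by gcongr; linarith
            _ = 2 ^ s * l ^ s := Real.mul_rpow (by norm_num) hl0
            _ ≤ _ := by nlinarith
      have h3 : 1 + intensity P n ρ (e z) ^ s = ENNReal.ofReal (1 + l ^ s) := by
        rw [ENNReal.ofReal_add zero_le_one (by positivity), ENNReal.ofReal_one,
          ← ENNReal.ofReal_rpow_of_nonneg hl0 hs, hl, ENNReal.ofReal_toReal (intensity_ne_top _ _ _)]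
      rw [h3, ← ENNReal.ofReal_mul (by positivity)]
      refine ENNReal.ofReal_le_ofReal ?_
      rw [mul_assoc _ (2 ^ s)]
      gcongr
  refine (lintegral_mono h1).trans ?_
  rw [lintegral_const_mul' _ _ ENNReal.ofReal_ne_top]
  gcongr
  rw [lintegral_add_left measurable_const, lintegral_const, measure_univ, one_mul]
  gcongr
  conv_rhs => rw [← hP, lintegral_map (by rw [hP]; exact hm.pow_const s) he, hP]

lemma lintegral_exp_neighbors_le {π : Measure (E d × E d)} [IsProbabilityMeasure π]
    {P : Measure (E d)} [IsProbabilityMeasure P] {e : E d × E d → E d} (he : Measurable e)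
    (hP : π.map e = P) {n m : ℕ} (hmn : m ≤ n) {ρ : ℝ} {l t : ℝ} (ht : 0 ≤ t)
    (hl : ∀ x, (intensity P n ρ x).toReal ≤ l) :
    ∫⁻ v, ENNReal.ofReal (Real.exp (t * (1 + neighbors n ρ e v)))
      ∂(π.prod (Measure.pi fun _ : Fin m => π)) ≤
      ENNReal.ofReal (Real.exp t * Real.exp (l * (Real.exp t - 1))) := by
  have hN := measurable_neighbors (m := m) n ρ he
  rw [lintegral_prod _ (by fun_prop)]
  have hreal : ∀ x, π.real (e ⁻¹' nbhd n ρ x) = P.real (nbhd n ρ x) := fun x => by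
    rw [← hP, map_measureReal_apply he (measurableSet_nbhd n ρ x)]
  have h1 : ∀ z : E d × E d, ∫⁻ w, ENNReal.ofReal (Real.exp (t * (1 + neighbors n ρ e (z, w))))
      ∂(Measure.pi fun _ : Fin m => π) ≤
        ENNReal.ofReal (Real.exp t * Real.exp (l * (Real.exp t - 1))) := by
    intro z
    have hB : MeasurableSet (e ⁻¹' nbhd n ρ (e z)) := he (measurableSet_nbhd n ρ _)
    simp_rw [neighbors_mk, mul_add, mul_one, Real.exp_add, ENNReal.ofReal_mul (Real.exp_pos t).le]
    rw [lintegral_const_mul' _ _ ENNReal.ofReal_ne_top]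
    gcongr
    refine (lintegral_exp_hits_le π m hB t).trans ?_
    gcongr
    · linarith [Real.one_le_exp ht]
    · rw [hreal]
      exact (ofReal_mul_measureReal_nbhd_le hmn ρ (e z)).trans (hl _)
  refine (lintegral_mono h1).trans ?_
  rw [lintegral_const, measure_univ, mul_one]

end PairSamples

/-! ### Efron–Stein for the difference of two coupled statistics. -/

section VarianceBound

variable {d : ℕ}

/-- The scaled points of the pairs `w`, under the projection `e`. -/
def scaledPoints {m : ℕ} (n : ℕ) (e : E d × E d → E d) (w : Fin m → E d × E d) : Multiset (E d) :=
  Finset.univ.val.map fun i => ((n : ℝ) ^ ((d : ℝ)⁻¹)) • e (w i)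

lemma scaledPoints_succ {m : ℕ} (n : ℕ) (e : E d × E d → E d) (w : Fin (m + 1) → E d × E d)
    (j : Fin (m + 1)) :
    scaledPoints n e w =
      ((n : ℝ) ^ ((d : ℝ)⁻¹)) • e (w j) ::ₘ scaledPoints n e fun i => w (j.succAbove i) := by
  rw [scaledPoints, Fin.univ_succAbove m j, Finset.cons_val, Multiset.map_cons, Finset.map_val,
    Multiset.map_map]
  rfl

lemma card_nearPart_scaledPoints {m : ℕ} (n : ℕ) (ρ : ℝ) (e : E d × E d → E d)
    (v : (E d × E d) × (Fin m → E d × E d)) :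
    ((nearPart ρ (((n : ℝ) ^ ((d : ℝ)⁻¹)) • e v.1) (scaledPoints n e v.2)).card : ℝ) =
      neighbors n ρ e v := by
  classical
  have h : neighbors n ρ e v = ∑ i, if dist (((n : ℝ) ^ ((d : ℝ)⁻¹)) • e v.1)
      (((n : ℝ) ^ ((d : ℝ)⁻¹)) • e (v.2 i)) ≤ ρ then (1 : ℝ) else 0 := by
    rw [neighbors, hits]
    refine Finset.sum_congr rfl fun i _ => ?_
    rw [Set.indicator_apply]
    rfl
  rw [h, Finset.sum_boole, nearPart, scaledPoints, Multiset.filter_map, Multiset.card_map]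
  norm_cast

/-- Off the event, the central pair is diagonal, and so is every pair near it; an off-diagonal pair
is near in neither coordinate. So both sides see the same neighbours. -/
lemma nearPart_scaledPoints_congr {m : ℕ} {n : ℕ} {ρ : ℝ}
    {v : (E d × E d) × (Fin m → E d × E d)} (hv : v ∉ discrepancySet d n ρ m) :
    nearPart ρ (((n : ℝ) ^ ((d : ℝ)⁻¹)) • v.1.1) (scaledPoints n Prod.fst v.2) =
      nearPart ρ (((n : ℝ) ^ ((d : ℝ)⁻¹)) • v.1.2) (scaledPoints n Prod.snd v.2) := by
  classical
  simp only [discrepancySet, Set.mem_union, Set.mem_iUnion, Set.mem_ofPred_eq, not_or, not_exists,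
    not_and, not_not, nearSet] at hv
  obtain ⟨h0, h1, h2⟩ := hv
  rw [nearPart, nearPart, scaledPoints, scaledPoints, Multiset.filter_map, Multiset.filter_map]
  have hfilter : ∀ i, (dist (((n : ℝ) ^ ((d : ℝ)⁻¹)) • v.1.1)
      (((n : ℝ) ^ ((d : ℝ)⁻¹)) • (v.2 i).1) ≤ ρ ↔ dist (((n : ℝ) ^ ((d : ℝ)⁻¹)) • v.1.2)
      (((n : ℝ) ^ ((d : ℝ)⁻¹)) • (v.2 i).2) ≤ ρ) ∧ (dist (((n : ℝ) ^ ((d : ℝ)⁻¹)) • v.1.1)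
      (((n : ℝ) ^ ((d : ℝ)⁻¹)) • (v.2 i).1) ≤ ρ → (v.2 i).1 = (v.2 i).2) := by
    intro i
    by_cases hi : (v.2 i).1 = (v.2 i).2
    · exact ⟨by rw [h0, hi], fun _ => hi⟩
    · exact ⟨iff_of_false (h1 i hi) (h2 i hi), fun h => absurd h (h1 i hi)⟩
  have hf : Multiset.filter ((fun x => dist (((n : ℝ) ^ ((d : ℝ)⁻¹)) • v.1.1) x ≤ ρ) ∘
      fun i => ((n : ℝ) ^ ((d : ℝ)⁻¹)) • (v.2 i).1) Finset.univ.val =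
      Multiset.filter ((fun x => dist (((n : ℝ) ^ ((d : ℝ)⁻¹)) • v.1.2) x ≤ ρ) ∘
        fun i => ((n : ℝ) ^ ((d : ℝ)⁻¹)) • (v.2 i).2) Finset.univ.val :=
    Multiset.filter_congr fun i _ => (hfilter i).1
  rw [← hf]
  refine Multiset.map_congr rfl fun i hi => ?_
  rw [(hfilter i).2 (Multiset.mem_filter.1 hi).2]

/-- Atomless marginals exclude repeated points almost surely. This supplies the distinctness needed
to apply (K1) when a point is removed. -/
lemma ae_injective_sample {π : Measure (E d × E d)} [IsProbabilityMeasure π] {P : Measure (E d)}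
    [NullSingletonClass P] {e : E d × E d → E d} (he : Measurable e) (hP : π.map e = P) (m : ℕ) :
    ∀ᵐ w ∂(Measure.pi fun _ : Fin (m + 1) => π), Function.Injective fun i => e (w i) := by
  have : IsProbabilityMeasure P := hP ▸ Measure.isProbabilityMeasure_map he.aemeasurable
  have h1 : ∀ i : Fin m, ∀ᵐ v ∂(π.prod (Measure.pi fun _ : Fin m => π)), e v.1 ≠ e (v.2 i) := by
    intro i
    have hmp : MeasurePreserving (Prod.map id (Function.eval i))
        (π.prod (Measure.pi fun _ : Fin m => π)) (π.prod π) :=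
      (MeasurePreserving.id π).prod (measurePreserving_eval _ i)
    have h2 : ∀ᵐ u ∂(π.prod π), e u.1 ≠ e u.2 := by
      have hs : MeasurableSet {u : (E d × E d) × (E d × E d) | e u.1 ≠ e u.2} :=
        (measurableSet_eq_fun (he.comp measurable_fst) (he.comp measurable_snd)).compl
      rw [Measure.ae_prod_iff_ae_ae hs]
      refine ae_of_all _ fun z => ?_
      have h3 : ∀ᵐ x ∂P, e z ≠ x := by
        rw [ae_iff]
        simp
      rw [← hP] at h3
      exact ae_of_ae_map he.aemeasurable h3
    exact hmp.quasiMeasurePreserving.ae h2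
  have h4 : ∀ j : Fin (m + 1), ∀ᵐ w ∂(Measure.pi fun _ : Fin (m + 1) => π),
      ∀ i : Fin m, e (w j) ≠ e (w (j.succAbove i)) := by
    intro j
    rw [ae_all_iff]
    intro i
    exact (measurePreserving_piFinSuccAbove (fun _ : Fin (m + 1) => π)
      j).quasiMeasurePreserving.ae (h1 i)
  filter_upwards [ae_all_iff.2 h4] with w hw i j hij
  by_contra hne
  obtain ⟨k, rfl⟩ := Fin.exists_succAbove_eq hne
  exact hw j k hij.symm

lemma nodup_scaledPoints {m n : ℕ} (hn : 0 < n) {e : E d × E d → E d} {w : Fin m → E d × E d}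
    (hw : Function.Injective fun i => e (w i)) : (scaledPoints n e w).Nodup := by
  refine Multiset.Nodup.map (fun i j hij => ?_) Finset.univ.nodup
  have hn' : (0 : ℝ) < n := by exact_mod_cast hn
  have hc : (n : ℝ) ^ ((d : ℝ)⁻¹) ≠ 0 := by positivity
  exact hw (smul_right_injective (E d) hc hij)

/-- The bound for the mean squared effect of removing one pair. -/
def pairMoment (q n : ℕ) (ρ : ℝ) (m : ℕ) (π : Measure (E d × E d)) : ℝ≥0∞ :=
  ∫⁻ v in discrepancySet d n ρ m, ENNReal.ofReal ((1 + neighbors n ρ Prod.fst v) ^ (2 * q))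
      ∂(π.prod (Measure.pi fun _ : Fin m => π)) +
    ∫⁻ v in discrepancySet d n ρ m, ENNReal.ofReal ((1 + neighbors n ρ Prod.snd v) ^ (2 * q))
      ∂(π.prod (Measure.pi fun _ : Fin m => π))

variable {L : Multiset (E d) → PreAbstractSimplicialComplex (E d × ℕ)}

/-- The left side is the squared difference of two add-one costs. Off the discrepancy event they
coincide by locality; on it, (a-b)² ≤ 2a² + 2b² and each cost has its polynomial bound. -/
lemma sq_removal_le {ρ : ℝ} (hV : VerticesIn L) (hK : AddsStar L) (hD : DiamLE L ρ) (q : ℕ)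
    {m n : ℕ} (hn : 0 < n) {w : Fin (m + 1) → E d × E d}
    (h1 : Function.Injective fun i => (w i).1) (h2 : Function.Injective fun i => (w i).2)
    (j : Fin (m + 1)) :
    ENNReal.ofReal ((truncEuler q (L (scaledPoints n Prod.fst w)) -
        truncEuler q (L (scaledPoints n Prod.snd w)) -
      (truncEuler q (L (scaledPoints n Prod.fst fun i => w (j.succAbove i))) -
        truncEuler q (L (scaledPoints n Prod.snd fun i => w (j.succAbove i))))) ^ 2) ≤
      (discrepancySet d n ρ m).indicator (fun v => ENNReal.ofReal (2 * (q + 1) ^ 2) *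
        (ENNReal.ofReal ((1 + neighbors n ρ Prod.fst v) ^ (2 * q)) +
          ENNReal.ofReal ((1 + neighbors n ρ Prod.snd v) ^ (2 * q))))
        (w j, fun i => w (j.succAbove i)) := by
  have n1 := nodup_scaledPoints hn h1
  have n2 := nodup_scaledPoints hn h2
  rw [scaledPoints_succ n Prod.fst w j] at n1 ⊢
  rw [scaledPoints_succ n Prod.snd w j] at n2 ⊢
  have b1 := abs_truncEuler_cons_sub_le hV hK hD q n1
  have b2 := abs_truncEuler_cons_sub_le hV hK hD q n2
  have c1 := card_nearPart_scaledPoints n ρ Prod.fst (w j, fun i => w (j.succAbove i))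
  have c2 := card_nearPart_scaledPoints n ρ Prod.snd (w j, fun i => w (j.succAbove i))
  simp only at c1 c2
  rw [c1] at b1
  rw [c2] at b2
  by_cases hv : (w j, fun i => w (j.succAbove i)) ∈ discrepancySet d n ρ m
  · rw [Set.indicator_of_mem hv]
    have p1 := neighbors_nonneg n ρ Prod.fst (w j, fun i => w (j.succAbove i))
    have p2 := neighbors_nonneg n ρ Prod.snd (w j, fun i => w (j.succAbove i))
    rw [← ENNReal.ofReal_add (by positivity) (by positivity), ← ENNReal.ofReal_mul (by positivity)]
    refine ENNReal.ofReal_le_ofReal ?_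
    have s1 := sq_le_sq' (abs_le.1 b1).1 (abs_le.1 b1).2
    have s2 := sq_le_sq' (abs_le.1 b2).1 (abs_le.1 b2).2
    rw [mul_pow, ← pow_mul, mul_comm q 2] at s1 s2
    nlinarith [sq_nonneg
      (truncEuler q (L (((n : ℝ) ^ ((d : ℝ)⁻¹)) • (w j).1 ::ₘ
          scaledPoints n Prod.fst fun i => w (j.succAbove i))) -
        truncEuler q (L (scaledPoints n Prod.fst fun i => w (j.succAbove i))) +
        (truncEuler q (L (((n : ℝ) ^ ((d : ℝ)⁻¹)) • (w j).2 ::ₘ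
          scaledPoints n Prod.snd fun i => w (j.succAbove i))) -
        truncEuler q (L (scaledPoints n Prod.snd fun i => w (j.succAbove i)))))]
  · rw [Set.indicator_of_notMem hv]
    have hz : (w j).1 = (w j).2 := by
      by_contra h
      exact hv (Or.inl h)
    have hnear := nearPart_scaledPoints_congr hv
    simp only at hnear
    rw [hz] at n1 hnear ⊢
    have := truncEuler_cons_sub_congr hV hK hD q n1 n2 hnear
    rw [sub_sub_sub_comm, this, sub_self]
    simp

/-- The Efron–Stein bound for the difference of the statistics of two coupled samples. -/
lemma evariance_coupled_le {ρ : ℝ} (hV : VerticesIn L) (hK : AddsStar L) (hD : DiamLE L ρ) (q : ℕ)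
    (hmeas : MeasurableFunctional fun S => truncEuler q (L S))
    {π : Measure (E d × E d)} [IsProbabilityMeasure π] {P Q : Measure (E d)} [NullSingletonClass P]
    [NullSingletonClass Q] (hπ : IsCoupling π P Q) (m : ℕ) :
    evariance (fun w : Fin (m + 1) → E d × E d =>
      (√((m + 1 : ℕ) : ℝ))⁻¹ * (truncEuler q (L (scaledPoints (m + 1) Prod.fst w)) -
        truncEuler q (L (scaledPoints (m + 1) Prod.snd w)))) (Measure.pi fun _ => π) ≤
      ENNReal.ofReal (2 * (q + 1) ^ 2) * pairMoment q (m + 1) ρ m π := by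
  set n := m + 1 with hn
  have hn0 : 0 < n := Nat.succ_pos m
  have hmeas' : ∀ (k : ℕ) (e : E d × E d → E d), Measurable e →
      Measurable fun w : Fin k → E d × E d => truncEuler q (L (scaledPoints n e w)) := by
    intro k e he
    have h1 : Measurable fun w : Fin k → E d × E d => fun i => ((n : ℝ) ^ ((d : ℝ)⁻¹)) • e (w i) := by
      fun_prop
    exact (hmeas k).comp h1
  have hH : Measurable fun w : Fin n → E d × E d => truncEuler q (L (scaledPoints n Prod.fst w)) -
      truncEuler q (L (scaledPoints n Prod.snd w)) :=
    (hmeas' n _ measurable_fst).sub (hmeas' n _ measurable_snd)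
  have hdel : ∀ j : Fin n, Measurable fun w : Fin n → E d × E d =>
      fun i : Fin m => w (j.succAbove i) := fun j => by fun_prop
  -- The comparison function deletes the `j`-th pair but keeps the scaling factor of `n` points;
  -- otherwise the remaining points would move.
  have hG : ∀ j : Fin n, Measurable fun w : Fin n → E d × E d =>
      truncEuler q (L (scaledPoints n Prod.fst fun i : Fin m => w (j.succAbove i))) -
        truncEuler q (L (scaledPoints n Prod.snd fun i : Fin m => w (j.succAbove i))) := fun j =>
    ((hmeas' m _ measurable_fst).comp (hdel j)).sub ((hmeas' m _ measurable_snd).comp (hdel j))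
  have hcard : ∀ (e : E d × E d → E d) (w : Fin n → E d × E d),
      |truncEuler q (L (scaledPoints n e w))| ≤ (q + 1) * 2 ^ n := fun e w => by
    have := abs_truncEuler_le hV q (scaledPoints n e w)
    simpa [scaledPoints] using this
  have hES := evariance_pi_le_sum π hH (B := (q + 1) * 2 ^ n + (q + 1) * 2 ^ n)
    (fun w => (abs_sub _ _).trans (add_le_add (hcard _ w) (hcard _ w))) hG
    (fun j x a => by simp)
  have hterm : ∀ j : Fin n, ∫⁻ w, ENNReal.ofReal ((truncEuler q (L (scaledPoints n Prod.fst w)) -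
        truncEuler q (L (scaledPoints n Prod.snd w)) -
      (truncEuler q (L (scaledPoints n Prod.fst fun i : Fin m => w (j.succAbove i))) -
        truncEuler q (L (scaledPoints n Prod.snd fun i : Fin m => w (j.succAbove i))))) ^ 2)
        ∂(Measure.pi fun _ : Fin n => π) ≤
      ENNReal.ofReal (2 * (q + 1) ^ 2) * pairMoment q n ρ m π := by
    intro j
    have hm1 := measurable_neighbors (m := m) n ρ (e := Prod.fst (α := E d) (β := E d))
      measurable_fst
    have hm2 := measurable_neighbors (m := m) n ρ (e := Prod.snd (α := E d) (β := E d))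
      measurable_snd
    have hind : Measurable ((discrepancySet d n ρ m).indicator (fun v =>
        ENNReal.ofReal (2 * (q + 1) ^ 2) *
        (ENNReal.ofReal ((1 + neighbors n ρ Prod.fst v) ^ (2 * q)) +
          ENNReal.ofReal ((1 + neighbors n ρ Prod.snd v) ^ (2 * q))))) :=
      Measurable.indicator (by fun_prop) (measurableSet_discrepancySet d n ρ m)
    calc _ ≤ ∫⁻ w, (discrepancySet d n ρ m).indicator (fun v =>
            ENNReal.ofReal (2 * (q + 1) ^ 2) *
            (ENNReal.ofReal ((1 + neighbors n ρ Prod.fst v) ^ (2 * q)) +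
              ENNReal.ofReal ((1 + neighbors n ρ Prod.snd v) ^ (2 * q))))
            (MeasurableEquiv.piFinSuccAbove (fun _ : Fin (m + 1) => E d × E d) j w)
            ∂(Measure.pi fun _ : Fin n => π) := by
          refine lintegral_mono_ae ?_
          filter_upwards [ae_injective_sample measurable_fst hπ.1 m,
            ae_injective_sample measurable_snd hπ.2 m] with w h1 h2
          exact sq_removal_le hV hK hD q hn0 h1 h2 j
      _ = _ := by
          rw [(measurePreserving_piFinSuccAbove (fun _ : Fin (m + 1) => π) j).lintegral_comp hind,
            lintegral_indicator (measurableSet_discrepancySet d n ρ m),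
            lintegral_const_mul' _ _ ENNReal.ofReal_ne_top, lintegral_add_left (by fun_prop),
            pairMoment]
  -- The normalization `1 / n` cancels the `n` equal bounds.
  rw [evariance_mul, inv_pow, Real.sq_sqrt (Nat.cast_nonneg n)]
  calc ENNReal.ofReal ((n : ℝ)⁻¹) * _
      ≤ ENNReal.ofReal ((n : ℝ)⁻¹) *
          ∑ _j : Fin n, ENNReal.ofReal (2 * (q + 1) ^ 2) * pairMoment q n ρ m π := by
        gcongr
        exact hES.trans (Finset.sum_le_sum fun j _ => hterm j)
    _ = _ := by
        rw [Finset.sum_const, Finset.card_univ, Fintype.card_fin, nsmul_eq_mul, ← mul_assoc,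
          ENNReal.ofReal_inv_of_pos (by exact_mod_cast hn0), ENNReal.ofReal_natCast,
          ENNReal.inv_mul_cancel (by exact_mod_cast hn0.ne') (ENNReal.natCast_ne_top n), one_mul]

end VarianceBound

/-! ### Moments of the neighbour count on the discrepancy event. -/

section MomentBounds

variable {d : ℕ}

lemma setLIntegral_pow_le {α : Type*} [MeasurableSpace α] (μ : Measure α) (A : Set α) {Y : α → ℝ}
    (hY : Measurable Y) (hY0 : ∀ x, 0 ≤ Y x) {k : ℕ} {s : ℝ} (hs : 0 < s) (hk : k ≤ s) :
    ∫⁻ x in A, ENNReal.ofReal (Y x ^ k) ∂μ ≤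
      (∫⁻ x, ENNReal.ofReal (Y x ^ s) ∂μ) ^ (k / s) * μ A ^ (1 - k / s) := by
  have h := ENNReal.lintegral_mul_norm_pow_le (μ := μ.restrict A)
    (f := fun x => ENNReal.ofReal (Y x ^ s)) (g := fun _ => (1 : ℝ≥0∞)) (by fun_prop)
    aemeasurable_const (p := k / s) (q := 1 - k / s) (by positivity)
    (by rw [sub_nonneg, div_le_one hs]; exact hk) (by ring)
  simp only [ENNReal.one_rpow, mul_one, lintegral_const, one_mul,
    Measure.restrict_apply_univ] at h
  refine le_trans (le_of_eq (lintegral_congr fun x => ?_)) (h.trans ?_)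
  · rw [ENNReal.ofReal_rpow_of_nonneg (Real.rpow_nonneg (hY0 x) s) (by positivity),
      ← Real.rpow_mul (hY0 x), mul_div_cancel₀ _ hs.ne', Real.rpow_natCast]
  · gcongr
    exact Measure.restrict_le_self

lemma le_rpow_of_le_one {δ : ℝ≥0∞} (hδ : δ ≤ 1) {a : ℝ} (ha : a ≤ 1) : δ ≤ δ ^ a := by
  conv_lhs => rw [← ENNReal.rpow_one δ]
  exact ENNReal.rpow_le_rpow_of_exponent_ge hδ ha

/-- The bound under a moment condition on the intensities. -/
lemma pairMoment_le_rpow {π : Measure (E d × E d)} [IsProbabilityMeasure π] {P Q : Measure (E d)}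
    [IsProbabilityMeasure P] [IsProbabilityMeasure Q] (hπ : IsCoupling π P Q) {q n m : ℕ}
    (hmn : m ≤ n) (ρ : ℝ) {s : ℝ} (hs : 1 ≤ s) (hqs : 2 * q < s) {J : ℝ≥0∞}
    (hP : ∫⁻ x, intensity P n ρ x ^ s ∂P ≤ J) (hQ : ∫⁻ x, intensity Q n ρ x ^ s ∂Q ≤ J) :
    pairMoment q n ρ m π ≤
      2 * (ENNReal.ofReal ((1 + s) ^ s * Real.exp 3 * 2 ^ s) * (1 + J)) ^ (2 * q / s) *
        (1 + 2 * J ^ (1 / s)) ^ (1 - 2 * q / s) *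
          π {w | w.1 ≠ w.2} ^ ((1 - 1 / s) * (1 - 2 * q / s)) := by
  have hs0 : 0 < s := by linarith
  have hθ : 0 ≤ 1 - 2 * q / s := by
    rw [sub_nonneg, div_le_one hs0]
    exact hqs.le
  set δ := π {w | w.1 ≠ w.2} with hδ
  have hδ1 : δ ≤ 1 := prob_le_one
  have hA : (π.prod (Measure.pi fun _ : Fin m => π)) (discrepancySet d n ρ m) ≤
      (1 + 2 * J ^ (1 / s)) * δ ^ (1 - 1 / s) := by
    refine (measure_discrepancySet_le hπ hmn ρ).trans ?_
    have i1 := lintegral_intensity_offDiag_le measurable_fst hπ.1 n ρ hs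
    have i2 := lintegral_intensity_offDiag_le measurable_snd hπ.2 n ρ hs
    calc _ ≤ δ ^ (1 - 1 / s) + (J ^ (1 / s) * δ ^ (1 - 1 / s) + J ^ (1 / s) * δ ^ (1 - 1 / s)) := by
          gcongr ?_ + (?_ + ?_)
          -- Since `δ ≤ 1`, the term for the central pair is absorbed into the weaker power from the
          -- neighbours.
          · exact le_rpow_of_le_one hδ1 (by linarith [(by positivity : 0 ≤ 1 / s)])
          · exact i1.trans (by gcongr)
          · exact i2.trans (by gcongr)
      _ = _ := by ring
  -- Hölder between the moment of order `s` and the probability of the event; this needs `2 * q < s`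
  -- and gives the second factor of the exponent.
  have key : ∀ (e : E d × E d → E d) (P' : Measure (E d)) [IsProbabilityMeasure P'],
      Measurable e → π.map e = P' → ∫⁻ x, intensity P' n ρ x ^ s ∂P' ≤ J →
      ∫⁻ v in discrepancySet d n ρ m, ENNReal.ofReal ((1 + neighbors n ρ e v) ^ (2 * q))
        ∂(π.prod (Measure.pi fun _ : Fin m => π)) ≤
      (ENNReal.ofReal ((1 + s) ^ s * Real.exp 3 * 2 ^ s) * (1 + J)) ^ (2 * q / s) *
        ((1 + 2 * J ^ (1 / s)) * δ ^ (1 - 1 / s)) ^ (1 - 2 * q / s) := by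
    intro e P' _ he hR hJ
    have hN := measurable_neighbors (m := m) n ρ he
    have h := setLIntegral_pow_le (π.prod (Measure.pi fun _ : Fin m => π))
      (discrepancySet d n ρ m) (Y := fun v => 1 + neighbors n ρ e v) (by fun_prop)
      (fun v => by linarith [neighbors_nonneg n ρ e v]) (k := 2 * q) hs0
      (by push_cast; exact hqs.le)
    push_cast at h
    refine h.trans ?_
    gcongr
    exact (lintegral_neighbors_rpow_le he hR hmn ρ hs0.le).trans (by gcongr)
  refine (add_le_add (key _ P measurable_fst hπ.1 hP) (key _ Q measurable_snd hπ.2 hQ)).trans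
    (le_of_eq ?_)
  rw [ENNReal.mul_rpow_of_nonneg _ _ hθ, ← ENNReal.rpow_mul]
  ring

/-- Split at the threshold `l`. Above it, y^k ≤ k! e^y and the factor e^{t(y-l)} is at least 1. The
maximum with `0` covers negative `l`. -/
lemma pow_le_add_exp {y l t : ℝ} (hy : 0 ≤ y) (ht : 0 ≤ t) (k : ℕ) :
    y ^ k ≤ l ^ k ⊔ 0 + k.factorial * Real.exp (-(t * l)) * Real.exp ((1 + t) * y) := by
  rcases le_or_gt y l with h | h
  · have h1 : y ^ k ≤ l ^ k := by gcongr
    have h2 : 0 ≤ k.factorial * Real.exp (-(t * l)) * Real.exp ((1 + t) * y) := by positivity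
    linarith [le_max_left (l ^ k) 0]
  · have h1 := Real.pow_div_factorial_le_exp y hy k
    rw [div_le_iff₀ (by positivity)] at h1
    have h2 : Real.exp y ≤ Real.exp (-(t * l)) * Real.exp ((1 + t) * y) := by
      rw [← Real.exp_add]
      gcongr
      nlinarith
    have h3 : (0 : ℝ) ≤ k.factorial := by positivity
    nlinarith [le_max_right (l ^ k) 0]

/-- The bound for bounded intensities. -/
lemma pairMoment_le_exp {π : Measure (E d × E d)} [IsProbabilityMeasure π] {P Q : Measure (E d)}
    [IsProbabilityMeasure P] [IsProbabilityMeasure Q] (hπ : IsCoupling π P Q) {q n m : ℕ}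
    (hmn : m ≤ n) {ρ : ℝ} {Λ : ℝ} (hΛ : 0 ≤ Λ) (hP : ∀ x, intensity P n ρ x ≤ ENNReal.ofReal Λ)
    (hQ : ∀ x, intensity Q n ρ x ≤ ENNReal.ofReal Λ) {l t ε : ℝ} (hl : 0 ≤ l) (ht : 0 ≤ t)
    (hε : 0 ≤ ε) (hδ : π {w | w.1 ≠ w.2} ≤ ENNReal.ofReal ε) :
    pairMoment q n ρ m π ≤ ENNReal.ofReal (2 * (l ^ (2 * q) * ((1 + 2 * Λ) * ε) +
      (2 * q).factorial * Real.exp (-(t * l)) *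
        (Real.exp (1 + t) * Real.exp (Λ * (Real.exp (1 + t) - 1))))) := by
  have hA : (π.prod (Measure.pi fun _ : Fin m => π)) (discrepancySet d n ρ m) ≤
      ENNReal.ofReal ((1 + 2 * Λ) * ε) := by
    have hi : ∀ (e : E d × E d → E d) (R : Measure (E d)),
        (∀ x, intensity R n ρ x ≤ ENNReal.ofReal Λ) →
        ∫⁻ w in {w | w.1 ≠ w.2}, intensity R n ρ (e w) ∂π ≤ ENNReal.ofReal (Λ * ε) := by
      intro e R hR
      calc _ ≤ ∫⁻ w in {w | w.1 ≠ w.2}, ENNReal.ofReal Λ ∂π := lintegral_mono fun w => hR _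
        _ ≤ ENNReal.ofReal Λ * ENNReal.ofReal ε := by
          rw [lintegral_const, Measure.restrict_apply_univ]
          gcongr
        _ = _ := by rw [ENNReal.ofReal_mul hΛ]
    refine (measure_discrepancySet_le hπ hmn ρ).trans ((add_le_add hδ
      (add_le_add (hi Prod.fst P hP) (hi Prod.snd Q hQ))).trans (le_of_eq ?_))
    rw [← ENNReal.ofReal_add (by positivity) (by positivity),
      ← ENNReal.ofReal_add (by positivity) (by positivity)]
    congr 1
    ring
  have key : ∀ (e : E d × E d → E d) (R : Measure (E d)) [IsProbabilityMeasure R],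
      Measurable e → π.map e = R → (∀ x, intensity R n ρ x ≤ ENNReal.ofReal Λ) →
      ∫⁻ v in discrepancySet d n ρ m, ENNReal.ofReal ((1 + neighbors n ρ e v) ^ (2 * q))
        ∂(π.prod (Measure.pi fun _ : Fin m => π)) ≤
      ENNReal.ofReal (l ^ (2 * q) * ((1 + 2 * Λ) * ε) +
      (2 * q).factorial * Real.exp (-(t * l)) *
        (Real.exp (1 + t) * Real.exp (Λ * (Real.exp (1 + t) - 1)))) := by
    intro e R _ he hR hb
    have hN := measurable_neighbors (m := m) n ρ he
    calc _ ≤ ∫⁻ v in discrepancySet d n ρ m, (ENNReal.ofReal (l ^ (2 * q)) +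
          ENNReal.ofReal ((2 * q).factorial * Real.exp (-(t * l))) *
            ENNReal.ofReal (Real.exp ((1 + t) * (1 + neighbors n ρ e v))))
            ∂(π.prod (Measure.pi fun _ : Fin m => π)) := by
          refine lintegral_mono fun v => ?_
          rw [← ENNReal.ofReal_mul (by positivity), ← ENNReal.ofReal_add (by positivity)
            (by positivity)]
          refine ENNReal.ofReal_le_ofReal ?_
          have h := pow_le_add_exp (y := 1 + neighbors n ρ e v) (l := l) (t := t)
            (by linarith [neighbors_nonneg n ρ e v]) ht (2 * q)
          rwa [max_eq_left (by positivity)] at h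
      _ ≤ ENNReal.ofReal (l ^ (2 * q)) * ENNReal.ofReal ((1 + 2 * Λ) * ε) +
          ENNReal.ofReal ((2 * q).factorial * Real.exp (-(t * l))) *
            ENNReal.ofReal (Real.exp (1 + t) * Real.exp (Λ * (Real.exp (1 + t) - 1))) := by
          rw [lintegral_add_left measurable_const, lintegral_const, Measure.restrict_apply_univ,
            lintegral_const_mul' _ _ ENNReal.ofReal_ne_top]
          gcongr
          refine (setLIntegral_le_lintegral _ _).trans
            (lintegral_exp_neighbors_le he hR hmn (by linarith) fun x => ?_)
          exact ENNReal.toReal_le_of_le_ofReal hΛ (hb x)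
      _ = _ := by
          rw [← ENNReal.ofReal_mul (by positivity), ← ENNReal.ofReal_mul (by positivity),
            ← ENNReal.ofReal_add (by positivity) (by positivity)]
  refine (add_le_add (key _ P measurable_fst hπ.1 hP) (key _ Q measurable_snd hπ.2 hQ)).trans
    (le_of_eq ?_)
  rw [← ENNReal.ofReal_add (by positivity) (by positivity), ← two_mul]

end MomentBounds

/-! ### Consequences of an L^p bound on the density. -/

section DensityBounds

variable {d : ℕ} {p : ℝ≥0∞} {M : ℝ≥0} {P : Measure (E d)}

lemma IsDensity.enorm_eq {g : E d → ℝ} (hg : IsDensity g P) (x : E d) :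
    ‖g x‖ₑ = ENNReal.ofReal (g x) := Real.enorm_of_nonneg (hg.2.2.1 x)

lemma lintegral_intensity_rpow_le_of_mem (hd : 0 < d) (hP : P ∈ DensityClass d p M)
    (hp : 1 ≤ p.toReal) (hp' : p ≠ ∞) {n : ℕ} (hn : 0 < n) (ρ : ℝ) :
    ∫⁻ x, intensity P n ρ x ^ (p.toReal - 1) ∂P ≤
      (1 + ballVol d ρ ^ p.toReal) * (M : ℝ≥0∞) ^ p.toReal := by
  obtain ⟨g, hg, hgM⟩ := hP
  have h0 : p ≠ 0 := by
    rintro rfl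
    norm_num at hp
  have h := lintegral_intensity_rpow_le hd hn ρ (g := fun x => ENNReal.ofReal (g x))
    hg.2.1.ennreal_ofReal (s := p.toReal - 1) (by linarith)
  rw [← hg.2.2.2, sub_add_cancel] at h
  refine h.trans ?_
  gcongr
  rw [eLpNorm_eq_lintegral_rpow_enorm_toReal h0 hp', one_div,
    ENNReal.rpow_inv_le_iff (by linarith)] at hgM
  simpa only [hg.enorm_eq] using hgM

lemma intensity_le_of_mem (hd : 0 < d) (hP : P ∈ DensityClass d ∞ M) {n : ℕ} (hn : 0 < n)
    (ρ : ℝ) (x : E d) : intensity P n ρ x ≤ ENNReal.ofReal ((M * ballVol d ρ).toReal) := by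
  obtain ⟨g, hg, hgM⟩ := hP
  rw [ENNReal.ofReal_toReal (ENNReal.mul_ne_top ENNReal.coe_ne_top (ballVol_ne_top d ρ))]
  have h := intensity_le_of_ae_le hd hn ρ (g := fun x => ENNReal.ofReal (g x)) (M := M) ?_ x
  · rwa [← hg.2.2.2] at h
  · rw [eLpNorm_exponent_top] at hgM
    filter_upwards [ae_le_eLpNormEssSup (f := g) (μ := volume)] with x hx
    rw [hg.enorm_eq] at hx
    exact hx.trans hgM

lemma IsDensity.nullSingletonClass (hd : 0 < d) {g : E d → ℝ} (hg : IsDensity g P) :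
    NullSingletonClass P := by
  have : Nonempty (Fin d) := ⟨⟨0, hd⟩⟩
  refine ⟨fun x => ?_⟩
  rw [hg.2.2.2]
  exact withDensity_absolutelyContinuous _ _ (measure_singleton x)

end DensityBounds

/-! ### The rate as a function of total variation. -/

section Rates

variable {d : ℕ}

lemma IsCoupling.isProbabilityMeasure {α : Type*} [MeasurableSpace α] {π : Measure (α × α)}
    {P Q : Measure α} (hπ : IsCoupling π P Q) [IsProbabilityMeasure P] :
    IsProbabilityMeasure π := by
  constructor
  have h : π.map Prod.fst Set.univ = 1 := by rw [hπ.1, measure_univ]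
  rwa [Measure.map_apply measurable_fst MeasurableSet.univ, Set.preimage_univ] at h

lemma isProbabilityMeasure_of_mem {p : ℝ≥0∞} {M : ℝ≥0} {P : Measure (E d)}
    (hP : P ∈ DensityClass d p M) : IsProbabilityMeasure P := by
  obtain ⟨g, hg, -⟩ := hP
  exact hg.1

lemma exists_pairMoment_le_rate_of_ne_top (hd : 0 < d) (q : ℕ) {p : ℝ≥0∞} (hp2 : 2 < p)
    (hpq : 2 * (q : ℝ≥0∞) + 1 < p) (hp : p ≠ ∞) (M : ℝ≥0) (ρ : ℝ) :
    ∃ γ : ℝ → ℝ, (∀ ε, 0 < ε → 0 ≤ γ ε) ∧ γ =O[𝓝[>] 0] rate q p ∧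
      ∀ ε, 0 < ε → ∀ P ∈ DensityClass d p M, ∀ Q ∈ DensityClass d p M,
        ∀ π, IsCoupling π P Q → π {w | w.1 ≠ w.2} ≤ ENNReal.ofReal ε →
          ∀ m, pairMoment q (m + 1) ρ m π ≤ ENNReal.ofReal (γ ε) := by
  have hp2' : 2 < p.toReal := by
    have := (ENNReal.toReal_lt_toReal (by norm_num) hp).2 hp2
    simpa using this
  have hpq' : 2 * (q : ℝ) + 1 < p.toReal := by
    have := (ENNReal.toReal_lt_toReal (by finiteness) hp).2 hpq
    rwa [ENNReal.toReal_add (by finiteness) (by norm_num), ENNReal.toReal_mul,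
      ENNReal.toReal_natCast, ENNReal.toReal_ofNat, ENNReal.toReal_one] at this
  -- The moment of order `s` of the intensity under `P` costs the L^{s+1} norm of the density, so `p
  -- - 1` is the order that an L^p bound provides.
  set s := p.toReal - 1 with hs
  have hs1 : 1 < s := by linarith
  have hs0 : 0 < s := by linarith
  have hqs : 2 * (q : ℝ) < s := by linarith
  set J : ℝ≥0∞ := (1 + ballVol d ρ ^ p.toReal) * (M : ℝ≥0∞) ^ p.toReal with hJ
  have hJtop : J ≠ ∞ := by
    have h1 : ballVol d ρ ^ p.toReal ≠ ∞ :=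
      ENNReal.rpow_ne_top_of_nonneg (by linarith) (ballVol_ne_top d ρ)
    have h2 : (M : ℝ≥0∞) ^ p.toReal ≠ ∞ :=
      ENNReal.rpow_ne_top_of_nonneg (by linarith) ENNReal.coe_ne_top
    finiteness
  set C : ℝ≥0∞ := 2 * (ENNReal.ofReal ((1 + s) ^ s * Real.exp 3 * 2 ^ s) * (1 + J)) ^ (2 * q / s) *
        (1 + 2 * J ^ (1 / s)) ^ (1 - 2 * q / s) with hC
  have hθ : 0 ≤ 1 - 2 * q / s := by
    rw [sub_nonneg, div_le_one hs0]
    exact hqs.le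
  have hθ' : 0 ≤ 1 - 1 / s := by
    rw [sub_nonneg, div_le_one hs0]
    exact hs1.le
  have hCtop : C ≠ ∞ := by
    have h1 : J ^ (1 / s) ≠ ∞ := ENNReal.rpow_ne_top_of_nonneg (by positivity) hJtop
    have h2 : (ENNReal.ofReal ((1 + s) ^ s * Real.exp 3 * 2 ^ s) * (1 + J)) ^ (2 * q / s) ≠ ∞ :=
      ENNReal.rpow_ne_top_of_nonneg (by positivity) (by finiteness)
    have h3 : (1 + 2 * J ^ (1 / s)) ^ (1 - 2 * q / s) ≠ ∞ :=
      ENNReal.rpow_ne_top_of_nonneg hθ (by finiteness)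
    finiteness
  have hexp : (p.toReal - 2) / (p.toReal - 1) * (1 - 2 * q / (p.toReal - 1)) =
      (1 - 1 / s) * (1 - 2 * q / s) := by
    rw [← hs]
    congr 1
    field_simp
    rw [hs]
    ring
  have hrate : ∀ ε, rate q p ε = ε ^ ((1 - 1 / s) * (1 - 2 * q / s)) := fun ε => by
    rw [rate, if_neg hp, hexp]
  refine ⟨fun ε => C.toReal * rate q p ε, fun ε hε => ?_, (isBigO_refl _ _).const_mul_left _,
    fun ε hε P hP Q hQ π hπ hδ m => ?_⟩
  · simp only [hrate]
    positivity
  · have := isProbabilityMeasure_of_mem hP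
    have := isProbabilityMeasure_of_mem hQ
    have := hπ.isProbabilityMeasure
    have h := pairMoment_le_rpow hπ (q := q) (Nat.le_succ m) ρ hs1.le hqs (J := J)
      (lintegral_intensity_rpow_le_of_mem hd hP (by linarith) hp m.succ_pos ρ)
      (lintegral_intensity_rpow_le_of_mem hd hQ (by linarith) hp m.succ_pos ρ)
    refine h.trans ?_
    rw [← hC, ENNReal.ofReal_mul ENNReal.toReal_nonneg, ENNReal.ofReal_toReal hCtop, hrate,
      ← ENNReal.ofReal_rpow_of_nonneg hε.le (by positivity)]
    gcongr

/-- Here a = -log ε, with slope t = log a / 2 and threshold l = 4a / log a. Then t l = 2a, while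
e^{1+t} = e √a, so the generating function is only exp(O(√a)). Completing the square in √a leaves
e^{-a} = ε up to a constant. -/
lemma exp_tail_le {a Λ : ℝ} (ha : Real.exp 1 < a) (hΛ : 0 ≤ Λ) :
    Real.exp (-(Real.log a / 2 * (4 * (a / Real.log a)))) *
      (Real.exp (1 + Real.log a / 2) * Real.exp (Λ * (Real.exp (1 + Real.log a / 2) - 1))) ≤
      Real.exp (1 + (1 + Λ * Real.exp 1) ^ 2 / 4) * Real.exp (-a) := by
  have ha0 : 0 < a := (Real.exp_pos 1).trans ha
  have hlog : 1 < Real.log a := by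
    rwa [Real.lt_log_iff_exp_lt ha0]
  have h1 : Real.log a / 2 * (4 * (a / Real.log a)) = 2 * a := by
    field_simp
    ring
  have h2 : Real.exp (1 + Real.log a / 2) = Real.exp 1 * √a := by
    rw [Real.exp_add, Real.exp_half, Real.exp_log ha0]
  have hb : √a ≤ Real.exp (√a) := by linarith [Real.add_one_le_exp (√a)]
  have hsq : √a * √a = a := Real.mul_self_sqrt ha0.le
  rw [h1, h2]
  calc Real.exp (-(2 * a)) * (Real.exp 1 * √a * Real.exp (Λ * (Real.exp 1 * √a - 1)))
      ≤ Real.exp (-(2 * a)) * (Real.exp 1 * Real.exp (√a) *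
          Real.exp (Λ * (Real.exp 1 * √a - 1))) := by gcongr
    _ = Real.exp (-(2 * a) + (1 + √a + Λ * (Real.exp 1 * √a - 1))) := by
        rw [Real.exp_add, Real.exp_add, Real.exp_add]
    _ ≤ Real.exp (1 + (1 + Λ * Real.exp 1) ^ 2 / 4 + -a) := by
        refine Real.exp_le_exp.2 ?_
        nlinarith [sq_nonneg (√a - (1 + Λ * Real.exp 1) / 2)]
    _ = _ := by rw [Real.exp_add]

lemma exists_pairMoment_le_rate_top (hd : 0 < d) (q : ℕ) (M : ℝ≥0) (ρ : ℝ) :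
    ∃ γ : ℝ → ℝ, (∀ ε, 0 < ε → 0 ≤ γ ε) ∧ γ =O[𝓝[>] 0] rate q ∞ ∧
      ∀ ε, 0 < ε → ∀ P ∈ DensityClass d ∞ M, ∀ Q ∈ DensityClass d ∞ M,
        ∀ π, IsCoupling π P Q → π {w | w.1 ≠ w.2} ≤ ENNReal.ofReal ε →
          ∀ m, pairMoment q (m + 1) ρ m π ≤ ENNReal.ofReal (γ ε) := by
  set Λ : ℝ := (M * ballVol d ρ).toReal with hΛdef
  have hΛ : 0 ≤ Λ := ENNReal.toReal_nonneg
  set C : ℝ := 2 * (4 ^ (2 * q) * (1 + 2 * Λ) +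
    (2 * q).factorial * Real.exp (1 + (1 + Λ * Real.exp 1) ^ 2 / 4)) with hC
  -- The trivial bound for ε that is not small: threshold `1`, slope `0`, and off-diagonal
  -- probability at most `1`.
  set C' : ℝ := 2 * ((1 + 2 * Λ) + (2 * q).factorial *
    (Real.exp 1 * Real.exp (Λ * (Real.exp 1 - 1)))) with hC'
  have hC0 : 0 ≤ C := by positivity
  have hC'0 : 0 ≤ C' := by positivity
  -- for small `ε`, the number `a = -log ε` exceeds `e`
  have ha : ∀ ε, 0 < ε → ε < Real.exp (-Real.exp 1) → Real.exp 1 < -Real.log ε := by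
    intro ε hε h
    have := Real.log_lt_log hε h
    rw [Real.log_exp] at this
    linarith
  have hquot : ∀ ε, 0 < ε → ε < Real.exp (-Real.exp 1) →
      1 ≤ -Real.log ε / Real.log (-Real.log ε) := by
    intro ε hε h
    have h1 := ha ε hε h
    have h0 : 0 < -Real.log ε := (Real.exp_pos 1).trans h1
    have h2 : 1 < Real.log (-Real.log ε) := by rwa [Real.lt_log_iff_exp_lt h0]
    rw [one_le_div (by linarith)]
    linarith [Real.log_le_sub_one_of_pos h0]
  have hrate : ∀ ε, rate q ∞ ε =
      ε * (-Real.log ε / Real.log (-Real.log ε)) ^ (2 * q) := fun ε => by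
    rw [rate, if_pos rfl]
  classical
  refine ⟨fun ε => if ε < Real.exp (-Real.exp 1) then C * rate q ∞ ε else C', fun ε hε => ?_, ?_,
    fun ε hε P hP Q hQ π hπ hδ m => ?_⟩
  · beta_reduce
    split_ifs with h
    · have := hquot ε hε h
      rw [hrate]
      positivity
    · exact hC'0
  · refine ((isBigO_refl (rate q ∞) _).const_mul_left C).congr' ?_ EventuallyEq.rfl
    have : ∀ᶠ ε in 𝓝[>] (0 : ℝ), ε < Real.exp (-Real.exp 1) :=
      nhdsWithin_le_nhds (Iio_mem_nhds (Real.exp_pos _))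
    filter_upwards [this] with ε h
    rw [if_pos h]
  · have := isProbabilityMeasure_of_mem hP
    have := isProbabilityMeasure_of_mem hQ
    have := hπ.isProbabilityMeasure
    have hPi := fun x => intensity_le_of_mem hd hP m.succ_pos ρ x
    have hQi := fun x => intensity_le_of_mem hd hQ m.succ_pos ρ x
    by_cases h : ε < Real.exp (-Real.exp 1)
    · simp only [if_pos h]
      have h1 := ha ε hε h
      have h0 : 0 < -Real.log ε := (Real.exp_pos 1).trans h1
      have h2 : 1 < Real.log (-Real.log ε) := by rwa [Real.lt_log_iff_exp_lt h0]
      have h3 := hquot ε hε h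
      have h4 := exp_tail_le h1 hΛ
      rw [neg_neg (Real.log ε), Real.exp_log hε] at h4
      refine (pairMoment_le_exp hπ (q := q) (Nat.le_succ m) hΛ hPi hQi
        (l := 4 * (-Real.log ε / Real.log (-Real.log ε)))
        (t := Real.log (-Real.log ε) / 2) (by positivity) (by positivity) hε.le hδ).trans ?_
      refine ENNReal.ofReal_le_ofReal ?_
      -- The tail contributes order ε, which the main term ε X dominates because X ≥ 1.
      have h5 : 1 ≤ (-Real.log ε / Real.log (-Real.log ε)) ^ (2 * q) := one_le_pow₀ h3
      set X := (-Real.log ε / Real.log (-Real.log ε)) ^ (2 * q) with hX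
      have h6 : C * rate q ∞ ε = 2 * (4 ^ (2 * q) * X * ((1 + 2 * Λ) * ε) +
          (2 * q).factorial * (Real.exp (1 + (1 + Λ * Real.exp 1) ^ 2 / 4) * (ε * X))) := by
        rw [hrate, hC]
        ring
      rw [h6, mul_pow, ← hX, mul_assoc ((2 * q).factorial : ℝ)]
      have h7 : ε ≤ ε * X := le_mul_of_one_le_right hε.le h5
      exact mul_le_mul_of_nonneg_left (add_le_add le_rfl (mul_le_mul_of_nonneg_left
        (h4.trans (by gcongr)) (by positivity))) zero_le_two
    · simp only [if_neg h]
      have h6 := pairMoment_le_exp hπ (q := q) (Nat.le_succ m) hΛ hPi hQi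
        (l := 1) (t := 0) zero_le_one le_rfl zero_le_one
        (by rw [ENNReal.ofReal_one]; exact prob_le_one)
      simpa only [one_pow, one_mul, mul_one, zero_mul, neg_zero, Real.exp_zero, add_zero] using h6

lemma exists_pairMoment_le_rate (hd : 0 < d) (q : ℕ) {p : ℝ≥0∞} (hp2 : 2 < p)
    (hpq : 2 * (q : ℝ≥0∞) + 1 < p) (M : ℝ≥0) (ρ : ℝ) :
    ∃ γ : ℝ → ℝ, (∀ ε, 0 < ε → 0 ≤ γ ε) ∧ γ =O[𝓝[>] 0] rate q p ∧
      ∀ ε, 0 < ε → ∀ P ∈ DensityClass d p M, ∀ Q ∈ DensityClass d p M,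
        ∀ π, IsCoupling π P Q → π {w | w.1 ≠ w.2} ≤ ENNReal.ofReal ε →
          ∀ m, pairMoment q (m + 1) ρ m π ≤ ENNReal.ofReal (γ ε) := by
  by_cases hp : p = ∞
  · subst hp
    exact exists_pairMoment_le_rate_top hd q M ρ
  · exact exists_pairMoment_le_rate_of_ne_top hd q hp2 hpq hp M ρ

/-- For finite `p`, the strict inequalities on `p` make the exponent positive. For `p = ∞` and a =
-log ε, the rate is eventually at most a^{2q} e^{-a}. -/
lemma tendsto_rate (q : ℕ) {p : ℝ≥0∞} (hp2 : 2 < p) (hpq : 2 * (q : ℝ≥0∞) + 1 < p) :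
    Tendsto (rate q p) (𝓝[>] 0) (𝓝 0) := by
  by_cases hp : p = ∞
  · have hlog : Tendsto (fun ε : ℝ => -Real.log ε) (𝓝[>] 0) atTop :=
      tendsto_neg_atBot_atTop.comp Real.tendsto_log_nhdsGT_zero
    have h1 := (Real.tendsto_pow_mul_exp_neg_atTop_nhds_zero (2 * q)).comp hlog
    refine tendsto_of_tendsto_of_tendsto_of_le_of_le' tendsto_const_nhds h1 ?_ ?_
    · filter_upwards [self_mem_nhdsWithin, hlog.eventually_ge_atTop 1] with ε (hε : 0 < ε) ha
      have : 0 ≤ Real.log (-Real.log ε) := Real.log_nonneg ha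
      rw [rate, if_pos hp]
      positivity
    · filter_upwards [self_mem_nhdsWithin, hlog.eventually_ge_atTop (Real.exp 1)]
        with ε (hε : 0 < ε) ha
      have ha0 : 0 < -Real.log ε := (Real.exp_pos 1).trans_le ha
      have hl : 1 ≤ Real.log (-Real.log ε) := by rwa [Real.le_log_iff_exp_le ha0]
      rw [rate, if_pos hp, Function.comp_apply, neg_neg, Real.exp_log hε, mul_comm]
      gcongr
      exact div_le_self ha0.le hl
  · have hp2' : 2 < p.toReal := by
      have := (ENNReal.toReal_lt_toReal (by norm_num) hp).2 hp2
      simpa using this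
    have hpq' : 2 * (q : ℝ) + 1 < p.toReal := by
      have := (ENNReal.toReal_lt_toReal (by finiteness) hp).2 hpq
      rwa [ENNReal.toReal_add (by finiteness) (by norm_num), ENNReal.toReal_mul,
        ENNReal.toReal_natCast, ENNReal.toReal_ofNat, ENNReal.toReal_one] at this
    have hexp : 0 < (p.toReal - 2) / (p.toReal - 1) * (1 - 2 * q / (p.toReal - 1)) := by
      refine mul_pos (div_pos (by linarith) (by linarith)) ?_
      rw [sub_pos, div_lt_one (by linarith)]
      linarith
    have h : rate q p = fun ε : ℝ =>
        ε ^ ((p.toReal - 2) / (p.toReal - 1) * (1 - 2 * q / (p.toReal - 1))) := by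
      ext ε
      rw [rate, if_neg hp]
    rw [h]
    have h0 := (Real.continuousAt_rpow_const 0
      ((p.toReal - 2) / (p.toReal - 1) * (1 - 2 * q / (p.toReal - 1))) (Or.inr hexp.le)).tendsto
    rw [Real.zero_rpow hexp.ne'] at h0
    exact h0.mono_left nhdsWithin_le_nhds

end Rates

/-! ### From the variance bound to distances between laws. -/

section CoupledLaws

variable {d : ℕ}

/-- A functional that is bounded on multisets of every fixed size. -/
def BoundedFunctional (ψ : Multiset (E d) → ℝ) : Prop :=
  ∀ n : ℕ, ∃ B, ∀ S : Multiset (E d), S.card = n → |ψ S| ≤ B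

lemma measurePreserving_sample {π : Measure (E d × E d)} [IsProbabilityMeasure π]
    {P : Measure (E d)} [IsProbabilityMeasure P] {e : E d × E d → E d} (he : Measurable e)
    (hP : π.map e = P) (n : ℕ) :
    MeasurePreserving (fun (w : Fin n → E d × E d) i => e (w i)) (Measure.pi fun _ => π)
      (sampleLaw n P) :=
  measurePreserving_pi _ _ fun _ => ⟨he, hP⟩

lemma MeasurableFunctional.scaledSample {ψ : Multiset (E d) → ℝ} (hψ : MeasurableFunctional ψ)
    (n : ℕ) : Measurable fun x : Fin n → E d => ψ (scaledSample n x) := by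
  have h1 : Measurable fun (x : Fin n → E d) i => ((n : ℝ) ^ ((d : ℝ)⁻¹)) • x i := by fun_prop
  exact (hψ n).comp h1

lemma MeasurableFunctional.standardized {ψ : Multiset (E d) → ℝ} (hψ : MeasurableFunctional ψ)
    (n : ℕ) (P : Measure (E d)) : Measurable (standardized ψ n P) :=
  ((hψ.scaledSample n).sub_const _).const_mul _

/-- The mean squared distance of the coupled standardized statistics. -/
lemma lintegral_standardized_sub_sq {ψ : Multiset (E d) → ℝ} (hψ : MeasurableFunctional ψ)
    (hb : BoundedFunctional ψ) {π : Measure (E d × E d)} [IsProbabilityMeasure π]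
    {P Q : Measure (E d)} [IsProbabilityMeasure P] [IsProbabilityMeasure Q]
    (hπ : IsCoupling π P Q) (n : ℕ) :
    ∫⁻ w, ENNReal.ofReal ((standardized ψ n P (fun i => (w i).1) -
        standardized ψ n Q (fun i => (w i).2)) ^ 2) ∂(Measure.pi fun _ : Fin n => π) =
      evariance (fun w : Fin n → E d × E d => (√(n : ℝ))⁻¹ *
        (ψ (scaledSample n fun j => (w j).1) - ψ (scaledSample n fun j => (w j).2)))
        (Measure.pi fun _ => π) := by
  obtain ⟨B, hB⟩ := hb n
  have hm := hψ.scaledSample n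
  have hB' : ∀ x : Fin n → E d, |ψ (scaledSample n x)| ≤ B := fun x => hB _ (by simp [scaledSample])
  have m1 := measurePreserving_sample measurable_fst hπ.1 n
  have m2 := measurePreserving_sample measurable_snd hπ.2 n
  have i1 : ∫ w, ψ (scaledSample n fun j => (w j).1) ∂(Measure.pi fun _ : Fin n => π) =
      ∫ y, ψ (scaledSample n y) ∂(sampleLaw n P) := by
    rw [← m1.map_eq, integral_map m1.measurable.aemeasurable hm.aestronglyMeasurable]
  have i2 : ∫ w, ψ (scaledSample n fun j => (w j).2) ∂(Measure.pi fun _ : Fin n => π) =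
      ∫ y, ψ (scaledSample n y) ∂(sampleLaw n Q) := by
    rw [← m2.map_eq, integral_map m2.measurable.aemeasurable hm.aestronglyMeasurable]
  have j1 : Integrable (fun w : Fin n → E d × E d => ψ (scaledSample n fun j => (w j).1))
      (Measure.pi fun _ => π) :=
    (memLp_of_abs_le (hm.comp m1.measurable) (fun w => hB' _) 1).integrable le_rfl
  have j2 : Integrable (fun w : Fin n → E d × E d => ψ (scaledSample n fun j => (w j).2))
      (Measure.pi fun _ => π) :=
    (memLp_of_abs_le (hm.comp m2.measurable) (fun w => hB' _) 1).integrable le_rfl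
  rw [evariance_eq_lintegral_ofReal, integral_const_mul, integral_sub j1 j2, i1, i2]
  refine lintegral_congr fun w => ?_
  rw [standardized, standardized]
  congr 2
  ring

/-- The joint law of the two standardized statistics is an admissible coupling, and its cost is the
variance of the difference because both are centred. -/
lemma W2_le {ψ : Multiset (E d) → ℝ} (hψ : MeasurableFunctional ψ)
    (hb : BoundedFunctional ψ) {π : Measure (E d × E d)} [IsProbabilityMeasure π]
    {P Q : Measure (E d)} [IsProbabilityMeasure P] [IsProbabilityMeasure Q]
    (hπ : IsCoupling π P Q) (n : ℕ) {c : ℝ} (hc : 0 ≤ c)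
    (hvar : evariance (fun w : Fin n → E d × E d => (√(n : ℝ))⁻¹ *
        (ψ (scaledSample n fun j => (w j).1) - ψ (scaledSample n fun j => (w j).2)))
        (Measure.pi fun _ => π) ≤ ENNReal.ofReal c) :
    W2 (standardizedLaw ψ n P) (standardizedLaw ψ n Q) ≤ ENNReal.ofReal √c := by
  have m1 := measurePreserving_sample measurable_fst hπ.1 n
  have m2 := measurePreserving_sample measurable_snd hπ.2 n
  have s1 := (hψ.standardized n P).comp m1.measurable
  have s2 := (hψ.standardized n Q).comp m2.measurable
  have hpair : Measurable fun w : Fin n → E d × E d =>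
      (standardized ψ n P (fun i => (w i).1), standardized ψ n Q (fun i => (w i).2)) :=
    s1.prodMk s2
  rw [W2, Real.sqrt_eq_rpow, ← ENNReal.ofReal_rpow_of_nonneg hc (by norm_num)]
  gcongr
  refine (iInf₂_le ((Measure.pi fun _ : Fin n => π).map fun w =>
    (standardized ψ n P (fun i => (w i).1), standardized ψ n Q (fun i => (w i).2)))
    ⟨?_, ?_⟩).trans (le_of_eq_of_le ?_ hvar)
  · rw [lintegral_map (by fun_prop) hpair, ← lintegral_standardized_sub_sq hψ hb hπ n]
  · rw [Measure.map_map measurable_fst hpair, standardizedLaw, ← m1.map_eq,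
      Measure.map_map (hψ.standardized n P) m1.measurable]
    rfl
  · rw [Measure.map_map measurable_snd hpair, standardizedLaw, ← m2.map_eq,
      Measure.map_map (hψ.standardized n Q) m2.measurable]
    rfl

lemma isProbabilityMeasure_standardizedJointLaw {k : ℕ} {ψ : Fin k → Multiset (E d) → ℝ}
    (hψ : ∀ i, MeasurableFunctional (ψ i)) (n : ℕ) (P : Measure (E d)) [IsProbabilityMeasure P] :
    IsProbabilityMeasure (standardizedJointLaw ψ n P) :=
  Measure.isProbabilityMeasure_map
    (measurable_pi_lambda _ fun i => (hψ i).standardized n P).aemeasurable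

/-- Integrals of Lipschitz functions with respect to the joint laws of coupled statistics. -/
lemma abs_integral_standardizedJointLaw_sub_le {k : ℕ} {ψ : Fin k → Multiset (E d) → ℝ}
    (hψ : ∀ i, MeasurableFunctional (ψ i)) (hb : ∀ i, BoundedFunctional (ψ i))
    {π : Measure (E d × E d)} [IsProbabilityMeasure π]
    {P Q : Measure (E d)} [IsProbabilityMeasure P] [IsProbabilityMeasure Q]
    (hπ : IsCoupling π P Q) (n : ℕ) {c : ℝ} (hc : 0 ≤ c)
    (hvar : ∀ i, evariance (fun w : Fin n → E d × E d => (√(n : ℝ))⁻¹ *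
        (ψ i (scaledSample n fun j => (w j).1) - ψ i (scaledSample n fun j => (w j).2)))
        (Measure.pi fun _ => π) ≤ ENNReal.ofReal c)
    {v : (Fin k → ℝ) → ℝ} {B : ℝ} (hv : ∀ x, |v x| ≤ B) {C : ℝ≥0} (hC : LipschitzWith C v) :
    |∫ t, v t ∂(standardizedJointLaw ψ n P) - ∫ t, v t ∂(standardizedJointLaw ψ n Q)| ≤
      C * (k * √c) := by
  have m1 := measurePreserving_sample measurable_fst hπ.1 n
  have m2 := measurePreserving_sample measurable_snd hπ.2 n
  set U : (Fin n → E d × E d) → Fin k → ℝ :=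
    fun w i => standardized (ψ i) n P (fun j => (w j).1) with hU
  set V : (Fin n → E d × E d) → Fin k → ℝ :=
    fun w i => standardized (ψ i) n Q (fun j => (w j).2) with hV
  have hUm : Measurable U := measurable_pi_lambda _ fun i =>
    ((hψ i).standardized n P).comp m1.measurable
  have hVm : Measurable V := measurable_pi_lambda _ fun i =>
    ((hψ i).standardized n Q).comp m2.measurable
  have l1 : standardizedJointLaw ψ n P = (Measure.pi fun _ : Fin n => π).map U := by
    rw [standardizedJointLaw, ← m1.map_eq, Measure.map_map
      (measurable_pi_lambda _ fun i => (hψ i).standardized n P) m1.measurable]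
    rfl
  have l2 : standardizedJointLaw ψ n Q = (Measure.pi fun _ : Fin n => π).map V := by
    rw [standardizedJointLaw, ← m2.map_eq, Measure.map_map
      (measurable_pi_lambda _ fun i => (hψ i).standardized n Q) m2.measurable]
    rfl
  have hvm : Measurable v := hC.continuous.measurable
  have hvU : Measurable fun w => v (U w) := hvm.comp hUm
  have hvV : Measurable fun w => v (V w) := hvm.comp hVm
  have hUV : ∀ i, Measurable fun w => U w i - V w i := fun i =>
    ((measurable_pi_apply i).comp hUm).sub ((measurable_pi_apply i).comp hVm)
  rw [l1, l2, integral_map hUm.aemeasurable hvm.aestronglyMeasurable,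
    integral_map hVm.aemeasurable hvm.aestronglyMeasurable,
    ← integral_sub ((memLp_of_abs_le hvU (fun w => hv _) 1).integrable le_rfl)
      ((memLp_of_abs_le hvV (fun w => hv _) 1).integrable le_rfl)]
  -- The L^1 norm is at most the L^2 norm, and the latter is the root of the variance.
  have hi : ∀ i, ∫⁻ w, ENNReal.ofReal |U w i - V w i| ∂(Measure.pi fun _ : Fin n => π) ≤
      ENNReal.ofReal √c := by
    intro i
    have h := lintegral_le_rpow_mul_rpow (Measure.pi fun _ : Fin n => π)
      (g := fun w => ENNReal.ofReal |U w i - V w i|)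
      ((hUV i).abs.ennreal_ofReal).aemeasurable (s := 2) one_le_two
    rw [measure_univ, ENNReal.one_rpow, mul_one] at h
    refine h.trans ?_
    rw [Real.sqrt_eq_rpow, ← ENNReal.ofReal_rpow_of_nonneg hc (by norm_num)]
    gcongr
    refine le_of_eq_of_le ?_ (hvar i)
    rw [← lintegral_standardized_sub_sq (hψ i) (hb i) hπ n]
    refine lintegral_congr fun w => ?_
    rw [ENNReal.ofReal_rpow_of_nonneg (abs_nonneg _) zero_le_two, Real.rpow_two, sq_abs]
  have hpt : ∀ w, ENNReal.ofReal |v (U w) - v (V w)| ≤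
      ENNReal.ofReal C * ∑ i, ENNReal.ofReal |U w i - V w i| := by
    intro w
    rw [← ENNReal.ofReal_sum_of_nonneg fun i _ => abs_nonneg _, ← ENNReal.ofReal_mul C.coe_nonneg]
    refine ENNReal.ofReal_le_ofReal ?_
    have h := hC.dist_le_mul (U w) (V w)
    rw [Real.dist_eq] at h
    refine h.trans ?_
    gcongr
    -- The metric on `Fin k → ℝ` is the maximum metric; bounding it by the sum of coordinates
    -- produces the factor `k`.
    refine (dist_pi_le_iff (Finset.sum_nonneg fun i _ => abs_nonneg _)).2 fun i => ?_
    rw [Real.dist_eq]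
    exact Finset.single_le_sum (f := fun i => |U w i - V w i|) (fun i _ => abs_nonneg _)
      (Finset.mem_univ i)
  have hlint : ∫⁻ w, ENNReal.ofReal |v (U w) - v (V w)| ∂(Measure.pi fun _ : Fin n => π) ≤
      ENNReal.ofReal (C * (k * √c)) := by
    calc _ ≤ ∫⁻ w, ENNReal.ofReal C * ∑ i, ENNReal.ofReal |U w i - V w i|
          ∂(Measure.pi fun _ : Fin n => π) := lintegral_mono hpt
      _ = ENNReal.ofReal C * ∑ i, ∫⁻ w, ENNReal.ofReal |U w i - V w i|
          ∂(Measure.pi fun _ : Fin n => π) := by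
        rw [lintegral_const_mul' _ _ ENNReal.ofReal_ne_top,
          lintegral_finsetSum _ fun i _ => (hUV i).abs.ennreal_ofReal]
      _ ≤ ENNReal.ofReal C * ∑ _i : Fin k, ENNReal.ofReal √c := by
        gcongr with i
        exact hi i
      _ = _ := by
        rw [Finset.sum_const, Finset.card_univ, Fintype.card_fin, nsmul_eq_mul,
          ENNReal.ofReal_mul C.coe_nonneg, ENNReal.ofReal_mul (Nat.cast_nonneg k),
          ENNReal.ofReal_natCast]
  refine (abs_integral_le_integral_abs).trans ?_
  rw [integral_eq_lintegral_of_nonneg_ae (ae_of_all _ fun w => abs_nonneg _)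
    (Measurable.abs (by fun_prop)).aestronglyMeasurable]
  exact ENNReal.toReal_le_of_le_ofReal (by positivity) hlint

end CoupledLaws

/-! ### Total variation and the L^1 distance of densities. -/

section TotalVariation

variable {d : ℕ}

lemma tvDist_le_of_eLpNorm_sub_le {P Q : Measure (E d)} {f g : E d → ℝ} (hf : IsDensity f P)
    (hg : IsDensity g Q) {ε : ℝ} (hε : 0 ≤ ε)
    (h : eLpNorm (fun y => g y - f y) 1 volume ≤ ENNReal.ofReal ε) : tvDist P Q ≤ ε := by
  have key : ∀ {P Q : Measure (E d)} {f g : E d → ℝ}, IsDensity f P → IsDensity g Q →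
      eLpNorm (fun y => g y - f y) 1 volume ≤ ENNReal.ofReal ε →
      ∀ A, MeasurableSet A → Q.real A ≤ P.real A + ε := by
    intro P Q f g hf hg h A hA
    have := hf.1
    have := hg.1
    have h1 : Q A ≤ P A + ENNReal.ofReal ε := by
      rw [eLpNorm_one_eq_lintegral_enorm] at h
      have hfm := hf.2.1
      rw [hg.2.2.2, hf.2.2.2, withDensity_apply _ hA, withDensity_apply _ hA]
      calc ∫⁻ x in A, ENNReal.ofReal (g x)
          ≤ ∫⁻ x in A, (ENNReal.ofReal (f x) + ‖g x - f x‖ₑ) := by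
            refine lintegral_mono fun x => ?_
            rw [Real.enorm_eq_ofReal_abs, ← ENNReal.ofReal_add (hf.2.2.1 x) (abs_nonneg _)]
            exact ENNReal.ofReal_le_ofReal (by linarith [le_abs_self (g x - f x)])
        _ = (∫⁻ x in A, ENNReal.ofReal (f x)) + ∫⁻ x in A, ‖g x - f x‖ₑ :=
            lintegral_add_left hfm.ennreal_ofReal _
        _ ≤ _ := by
            gcongr
            exact (setLIntegral_le_lintegral _ _).trans h
    have h2 := ENNReal.toReal_mono (by finiteness) h1
    rwa [ENNReal.toReal_add (by finiteness) (by finiteness), ENNReal.toReal_ofReal hε] at h2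
  have h' : eLpNorm (fun y => f y - g y) 1 volume ≤ ENNReal.ofReal ε := by
    rw [← eLpNorm_neg]
    convert h using 2
    ext y
    simp
  have : Nonempty {A : Set (E d) // MeasurableSet A} := ⟨⟨∅, MeasurableSet.empty⟩⟩
  refine ciSup_le fun A => ?_
  rw [abs_le]
  constructor
  · linarith [key hf hg h A A.2]
  · linarith [key hg hf h' A A.2]

end TotalVariation

/-! ### Transfer of weak convergence between uniformly close laws. -/

section WeakConvergence

variable {k : ℕ} {G : Measure (Fin k → ℝ)}

/-- Bounded Lipschitz functions suffice as tests for weak convergence of probability laws. The proof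
converts between a bound on the function and a bound on its oscillation. -/
lemma weakConv_iff_lipschitz [IsProbabilityMeasure G] {L : ℕ → Measure (Fin k → ℝ)}
    (hL : ∀ n, IsProbabilityMeasure (L n)) :
    WeakConv L G ↔ ∀ (v : (Fin k → ℝ) → ℝ) (B : ℝ) (C : ℝ≥0), (∀ x, |v x| ≤ B) →
      LipschitzWith C v → Tendsto (fun n => ∫ t, v t ∂(L n)) atTop (𝓝 (∫ t, v t ∂G)) := by
  set Lp : ℕ → ProbabilityMeasure (Fin k → ℝ) := fun n => ⟨L n, hL n⟩
  set Gp : ProbabilityMeasure (Fin k → ℝ) := ⟨G, inferInstance⟩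
  have h1 : WeakConv L G ↔ Tendsto Lp atTop (𝓝 Gp) :=
    (ProbabilityMeasure.tendsto_iff_forall_integral_tendsto (μs := Lp) (μ := Gp)).symm
  rw [h1, tendsto_iff_forall_lipschitz_integral_tendsto]
  constructor
  · intro h v B C hB hC
    refine h v ⟨B + B, fun x y => ?_⟩ ⟨C, hC⟩
    rw [Real.dist_eq]
    exact (abs_sub _ _).trans (add_le_add (hB x) (hB y))
  · rintro h v ⟨B, hB⟩ ⟨C, hC⟩
    refine h v (|v 0| + B) C (fun x => ?_) hC
    have := hB x 0
    rw [Real.dist_eq] at this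
    calc |v x| = |v 0 + (v x - v 0)| := by ring_nf
      _ ≤ |v 0| + |v x - v 0| := abs_add_le _ _
      _ ≤ _ := by gcongr

/-- The laws in `R n ε` are close to `A n`, uniformly in large `n`, in the weak topology. -/
def UniformlyClose (A : ℕ → Measure (Fin k → ℝ)) (R : ℕ → ℝ≥0∞ → Set (Measure (Fin k → ℝ))) :
    Prop :=
  ∀ (v : (Fin k → ℝ) → ℝ) (B : ℝ) (C : ℝ≥0), (∀ x, |v x| ≤ B) → LipschitzWith C v →
    ∀ η : ℝ, 0 < η → ∃ ε : ℝ≥0∞, 0 < ε ∧ ∀ᶠ n in atTop, ∀ L ∈ R n ε,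
      |∫ t, v t ∂(A n) - ∫ t, v t ∂L| ≤ η

variable {A : ℕ → Measure (Fin k → ℝ)} {R : ℕ → ℝ≥0∞ → Set (Measure (Fin k → ℝ))}

/-- Closeness is assumed only for Lipschitz tests but is needed for all bounded continuous ones. If
it failed, bad laws chosen with ε = 1/(j+1) and indices tending to infinity would converge to `G` on
Lipschitz tests, hence weakly, against their choice. -/
lemma UniformlyClose.eventually_abs_integral_sub_lt [IsProbabilityMeasure G]
    (hA : ∀ n, IsProbabilityMeasure (A n)) (hR : ∀ n ε, ∀ L ∈ R n ε, IsProbabilityMeasure L)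
    (hmono : ∀ n, Monotone (R n)) (hAR : UniformlyClose A R) (hAG : WeakConv A G)
    (v : (Fin k → ℝ) →ᵇ ℝ) {η : ℝ} (hη : 0 < η) :
    ∃ ε : ℝ≥0∞, 0 < ε ∧ ∀ᶠ n in atTop, ∀ L ∈ R n ε, |∫ t, v t ∂L - ∫ t, v t ∂G| < η := by
  by_contra! hcon
  have hchoice : ∀ j : ℕ, ∃ n, j ≤ n ∧ ∃ L ∈ R n ((j : ℝ≥0∞) + 1)⁻¹,
      η ≤ |∫ t, v t ∂L - ∫ t, v t ∂G| := by
    intro j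
    have h := hcon ((j : ℝ≥0∞) + 1)⁻¹ (ENNReal.inv_pos.2 (by finiteness))
    rw [frequently_atTop] at h
    exact h j
  choose n hn L hL hbad using hchoice
  have hntop : Tendsto n atTop atTop := tendsto_atTop_mono hn tendsto_id
  have hεtop : Tendsto (fun j : ℕ => ((j : ℝ≥0∞) + 1)⁻¹) atTop (𝓝 0) := by
    have := ENNReal.tendsto_inv_nat_nhds_zero.comp (tendsto_add_atTop_nat 1)
    simpa [Function.comp_def] using this
  have hconv : WeakConv L G := by
    rw [weakConv_iff_lipschitz fun j => hR _ _ _ (hL j)]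
    intro u B C hB hC
    have hAu := ((weakConv_iff_lipschitz hA).1 hAG u B C hB hC).comp hntop
    have hdiff : Tendsto (fun j => ∫ t, u t ∂(A (n j)) - ∫ t, u t ∂(L j)) atTop (𝓝 0) := by
      rw [Metric.tendsto_nhds]
      intro θ hθ
      obtain ⟨ε, hε, hev⟩ := hAR u B C hB hC (θ / 2) (by positivity)
      filter_upwards [hntop.eventually hev, hεtop.eventually (Iio_mem_nhds hε)] with j h1 h2
      rw [Real.dist_eq, sub_zero]
      linarith [h1 (L j) (hmono _ (le_of_lt h2) (hL j))]
    have := hAu.sub hdiff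
    simpa [Function.comp_def] using this
  have hlim := hconv v
  rw [Metric.tendsto_nhds] at hlim
  obtain ⟨j, hj⟩ := (hlim η hη).exists
  rw [Real.dist_eq] at hj
  linarith [hbad j]

variable {Ω : Type*} [MeasurableSpace Ω] {μ : Measure Ω} [IsProbabilityMeasure μ]
  {B : ℕ → Ω → Measure (Fin k → ℝ)} {Z : ℕ → Ω → ℝ≥0∞}

/-- Forward, a large error at a fixed test forces `Z` to be large. Backward, the laws `A n` are
deterministic, so one good outcome for each large `n` suffices. -/
lemma UniformlyClose.weakConv_iff_weakConvInProb [IsProbabilityMeasure G]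
    (hA : ∀ n, IsProbabilityMeasure (A n)) (hR : ∀ n ε, ∀ L ∈ R n ε, IsProbabilityMeasure L)
    (hmono : ∀ n, Monotone (R n)) (hAR : UniformlyClose A R)
    (hB : ∀ᶠ n in atTop, ∀ᵐ ω ∂μ, ∀ ε, Z n ω < ε → B n ω ∈ R n ε) (hZ : ToZeroInProb μ Z) :
    WeakConv A G ↔ WeakConvInProb μ B G := by
  constructor
  · intro hAG v θ hθ
    -- Convergence in measure is tested at extended thresholds, including `∞`.
    obtain ⟨η, hη, hηθ⟩ : ∃ η : ℝ, 0 < η ∧ ENNReal.ofReal η ≤ θ := by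
      by_cases hθtop : θ = ∞
      · exact ⟨1, one_pos, hθtop ▸ le_top⟩
      · exact ⟨θ.toReal, ENNReal.toReal_pos hθ.ne' hθtop, (ENNReal.ofReal_toReal hθtop).le⟩
    obtain ⟨ε, hε, hev⟩ := hAR.eventually_abs_integral_sub_lt hA hR hmono hAG v hη
    refine tendsto_of_tendsto_of_tendsto_of_le_of_le' tendsto_const_nhds (hZ ε hε)
      (Eventually.of_forall fun _ => bot_le) ?_
    filter_upwards [hev, hB] with n h1 h2
    refine measure_mono_ae ?_
    filter_upwards [h2] with ω h3 h4
    change ε ≤ Z n ω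
    by_contra! hlt
    have h5 := h1 _ (h3 ε hlt)
    have h6 : θ ≤ edist (∫ t, v t ∂(B n ω)) (∫ t, v t ∂G) := h4
    rw [edist_dist, Real.dist_eq] at h6
    exact absurd (hηθ.trans h6) (not_le.2 ((ENNReal.ofReal_lt_ofReal_iff hη).2 h5))
  · intro hBG
    rw [weakConv_iff_lipschitz hA]
    intro u b C hb hC
    set v : (Fin k → ℝ) →ᵇ ℝ := BoundedContinuousFunction.ofNormedAddCommGroup u hC.continuous b hb
    have hv := hBG v
    rw [Metric.tendsto_nhds]
    intro η hη
    obtain ⟨ε, hε, hev⟩ := hAR u b C hb hC (η / 2) (by positivity)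
    -- Two events of probability below one half cannot cover the probability space.
    have hsmall : (0 : ℝ≥0∞) < 2⁻¹ := by norm_num
    filter_upwards [hev, hB, (hZ ε hε).eventually (Iio_mem_nhds hsmall),
      (hv (ENNReal.ofReal (η / 2)) (by positivity)).eventually (Iio_mem_nhds hsmall)]
      with n h1 h2 h3 h4
    -- some outcome is in none of the exceptional events
    obtain ⟨ω, hω1, hω2, hω3⟩ : ∃ ω, (∀ ε, Z n ω < ε → B n ω ∈ R n ε) ∧ Z n ω < ε ∧
        edist (∫ t, v t ∂(B n ω)) (∫ t, v t ∂G) < ENNReal.ofReal (η / 2) := by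
      by_contra! hcon
      have hle : μ Set.univ ≤ μ ({ω | ε ≤ Z n ω} ∪ {ω | ENNReal.ofReal (η / 2) ≤
          edist (∫ t, v t ∂(B n ω)) (∫ t, v t ∂G)}) := by
        refine measure_mono_ae ?_
        filter_upwards [h2] with ω hω _
        by_cases hz : Z n ω < ε
        · exact Or.inr (hcon ω hω hz)
        · exact Or.inl (not_lt.1 hz)
      have hlt := (hle.trans (measure_union_le _ _)).trans_lt (ENNReal.add_lt_add h3 h4)
      rw [measure_univ, ENNReal.inv_two_add_inv_two] at hlt
      exact lt_irrefl _ hlt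
    have h5 := h1 _ (hω1 ε hω2)
    rw [edist_dist, Real.dist_eq, ENNReal.ofReal_lt_ofReal_iff (by positivity)] at hω3
    have h6 : |∫ t, u t ∂(B n ω) - ∫ t, u t ∂G| < η / 2 := hω3
    rw [Real.dist_eq]
    calc |∫ t, u t ∂(A n) - ∫ t, u t ∂G|
        ≤ |∫ t, u t ∂(A n) - ∫ t, u t ∂(B n ω)| + |∫ t, u t ∂(B n ω) - ∫ t, u t ∂G| :=
          abs_sub_le _ _ _
      _ < η := by linarith

lemma UniformlyClose.weakConv_iff_weakConvAS [IsProbabilityMeasure G]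
    (hA : ∀ n, IsProbabilityMeasure (A n)) (hR : ∀ n ε, ∀ L ∈ R n ε, IsProbabilityMeasure L)
    (hmono : ∀ n, Monotone (R n)) (hAR : UniformlyClose A R)
    (hB : ∀ᵐ ω ∂μ, ∀ᶠ n in atTop, ∀ ε, Z n ω < ε → B n ω ∈ R n ε) (hZ : ToZeroAS μ Z) :
    WeakConv A G ↔ WeakConvAS μ B G := by
  constructor
  · intro hAG
    filter_upwards [hB, hZ] with ω h1 h2 v
    rw [Metric.tendsto_nhds]
    intro η hη
    obtain ⟨ε, hε, hev⟩ := hAR.eventually_abs_integral_sub_lt hA hR hmono hAG v hη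
    filter_upwards [hev, h1, h2.eventually (Iio_mem_nhds hε)] with n h3 h4 h5
    rw [Real.dist_eq]
    exact h3 _ (h4 ε h5)
  · intro hBG
    obtain ⟨ω, h1, h2, h3⟩ := (hB.and (hZ.and hBG)).exists
    rw [weakConv_iff_lipschitz hA]
    intro u b C hb hC
    have hu := h3 (BoundedContinuousFunction.ofNormedAddCommGroup u hC.continuous b hb)
    have hdiff : Tendsto (fun n => ∫ t, u t ∂(A n) - ∫ t, u t ∂(B n ω)) atTop (𝓝 0) := by
      rw [Metric.tendsto_nhds]
      intro η hη
      obtain ⟨ε, hε, hev⟩ := hAR u b C hb hC (η / 2) (by positivity)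
      filter_upwards [hev, h1, h2.eventually (Iio_mem_nhds hε)] with n h4 h5 h6
      rw [Real.dist_eq, sub_zero]
      linarith [h4 _ (h5 ε h6)]
    have := hdiff.add hu
    simpa using this

lemma WeakConv.comp {L : ℕ → Measure (Fin k → ℝ)} (h : WeakConv L G) {m : ℕ → ℕ}
    (hm : Tendsto m atTop atTop) : WeakConv (fun n => L (m n)) G :=
  fun v => (h v).comp hm

/-- The finitely many early indices have bounded values under `m`, so a large integer in the range
of `m` is attained at a late index, where convergence is already effective. -/
lemma weakConv_of_comp {L : ℕ → Measure (Fin k → ℝ)} {m : ℕ → ℕ}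
    (hm : ∀ᶠ N in atTop, N ∈ Set.range m) (h : WeakConv (fun n => L (m n)) G) : WeakConv L G := by
  intro v
  refine tendsto_def.2 fun s hs => ?_
  obtain ⟨n₀, hn₀⟩ := eventually_atTop.1 ((h v).eventually hs)
  obtain ⟨b, hb⟩ := ((Set.finite_Iio n₀).image m).bddAbove
  filter_upwards [hm, eventually_gt_atTop b] with N hN hbN
  obtain ⟨n, rfl⟩ := hN
  refine hn₀ n ?_
  by_contra! hlt
  exact absurd (hb ⟨n, hlt, rfl⟩) (not_le.2 hbN)

end WeakConvergence

/-! ### Uniform coupling for the given complexes, and the theorem. -/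

section Main

variable {d : ℕ}

lemma IsFiltration.verticesIn {K : ComplexFamily d} (hK : IsFiltration K) (r : ℝ) :
    VerticesIn (K r) := by
  intro S σ hσ
  convert hK.1 r S σ hσ

lemma exists_coupling_evariance_le (hd : 0 < d) (q : ℕ) {p : ℝ≥0∞} (hp2 : 2 < p)
    (hpq : 2 * (q : ℝ≥0∞) + 1 < p) {K : ComplexFamily d} (hK : IsFiltration K) (hK1 : CondK1 K)
    (hD1 : CondD1 K) {k : ℕ} (r : Fin k → ℝ)
    (hmeas : ∀ i, MeasurableFunctional fun S => truncEuler q (K (r i) S)) (M : ℝ≥0) :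
    ∃ γ : ℝ → ℝ, (∀ ε, 0 < ε → 0 ≤ γ ε) ∧ γ =O[𝓝[>] 0] rate q p ∧
      ∀ ε, 0 < ε → ∀ P ∈ DensityClass d p M, ∀ Q ∈ DensityClass d p M, tvDist P Q ≤ ε →
        ∃ π : Measure (E d × E d), IsCoupling π P Q ∧ ∀ n : ℕ, 1 ≤ n → ∀ i,
          evariance (fun w : Fin n → E d × E d => (√(n : ℝ))⁻¹ *
            (truncEuler q (K (r i) (scaledSample n fun j => (w j).1)) -
              truncEuler q (K (r i) (scaledSample n fun j => (w j).2))))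
            (Measure.pi fun _ => π) ≤ ENNReal.ofReal (γ ε) := by
  obtain ⟨φ, -, hφ⟩ := hD1
  -- The sum dominates every diameter bound, so one radius and one `γ` serve all coordinates.
  set ρ : ℝ := ∑ i, (φ (r i) : ℝ) with hρ
  obtain ⟨γ, hγ0, hγO, hγ⟩ := exists_pairMoment_le_rate hd q hp2 hpq M ρ
  refine ⟨fun ε => 2 * (q + 1) ^ 2 * γ ε, fun ε hε => mul_nonneg (by positivity) (hγ0 ε hε),
    hγO.const_mul_left _, ?_⟩
  intro ε hε P hP Q hQ htv
  obtain ⟨f, hf, -⟩ := id hP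
  obtain ⟨g, hg, -⟩ := id hQ
  have := hf.1
  have := hg.1
  have := hf.nullSingletonClass hd
  have := hg.nullSingletonClass hd
  obtain ⟨π, hπ, hδ⟩ := exists_coupling_le_tvDist volume hf.2.1.ennreal_ofReal
    hg.2.1.ennreal_ofReal hf.2.2.2 hg.2.2.2
  refine ⟨π, hπ, fun n hn i => ?_⟩
  have := hπ.isProbabilityMeasure
  obtain ⟨m, rfl⟩ : ∃ m, n = m + 1 := ⟨n - 1, by omega⟩
  have hV := hK.verticesIn (r i)
  have hA : AddsStar (K (r i)) := fun S z hz => hK1 (r i) S z hz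
  have hD : DiamLE (K (r i)) ρ := fun S σ hσ => (hφ (r i) S σ hσ).trans
    (Finset.single_le_sum (f := fun i => (φ (r i) : ℝ)) (fun i _ => (φ (r i)).coe_nonneg)
      (Finset.mem_univ i))
  refine (evariance_coupled_le hV hA hD q (hmeas i) hπ m).trans ?_
  rw [ENNReal.ofReal_mul (p := 2 * ((q : ℝ) + 1) ^ 2) (by positivity)]
  gcongr
  exact hγ ε hε P hP Q hQ π hπ (hδ.trans (ENNReal.ofReal_le_ofReal htv)) m

lemma boundedFunctional_truncEuler {K : ComplexFamily d} (hK : IsFiltration K) (q : ℕ) (r : ℝ) :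
    BoundedFunctional fun S => truncEuler q (K r S) :=
  fun n => ⟨(q + 1) * 2 ^ n, fun S hS =>
    hS ▸ abs_truncEuler_le (hK.verticesIn r) q S⟩

/-- The laws of the standardized statistics under distributions whose densities are within `ε` of `f`
in `L¹` and `L^p`. -/
def lawsNear {k : ℕ} (ψ : Fin k → Multiset (E d) → ℝ) (p : ℝ≥0∞) (f : E d → ℝ) (n : ℕ) (ε : ℝ≥0∞) :
    Set (Measure (Fin k → ℝ)) :=
  {L | ∃ (Q : Measure (E d)) (g : E d → ℝ), IsDensity g Q ∧
    max (eLpNorm (fun y => g y - f y) 1 volume) (eLpNorm (fun y => g y - f y) p volume) < ε ∧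
    L = standardizedJointLaw ψ n Q}

lemma uniformlyClose_lawsNear (hd : 0 < d) (q : ℕ) {p : ℝ≥0∞} (hp2 : 2 < p)
    (hpq : 2 * (q : ℝ≥0∞) + 1 < p) {K : ComplexFamily d} (hK : IsFiltration K) (hK1 : CondK1 K)
    (hD1 : CondD1 K) {k : ℕ} (r : Fin k → ℝ)
    (hmeas : ∀ i, MeasurableFunctional fun S => truncEuler q (K (r i) S))
    {F : Measure (E d)} {f : E d → ℝ} (hf : IsDensity f F) (hfp : eLpNorm f p volume < ∞)
    {m : ℕ → ℕ} (hm : Tendsto m atTop atTop) :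
    UniformlyClose (fun n => standardizedJointLaw (fun i S => truncEuler q (K (r i) S)) (m n) F)
      (fun n => lawsNear (fun i S => truncEuler q (K (r i) S)) p f (m n)) := by
  intro v B C hB hC η hη
  -- Room for `f` and for every density within L^p distance `1` of it; the L^1 distance will control
  -- total variation.
  set M : ℝ≥0 := 1 + (eLpNorm f p volume).toNNReal with hM
  have hMcoe : (M : ℝ≥0∞) = 1 + eLpNorm f p volume := by
    rw [hM, ENNReal.coe_add, ENNReal.coe_one, ENNReal.coe_toNNReal hfp.ne]
  obtain ⟨γ, hγ0, hγO, hγ⟩ := exists_coupling_evariance_le hd q hp2 hpq hK hK1 hD1 r hmeas M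
  have hlim : Tendsto (fun ε => (C : ℝ) * (k * √(γ ε))) (𝓝[>] 0) (𝓝 0) := by
    have := ((hγO.trans_tendsto (tendsto_rate q hp2 hpq)).sqrt.const_mul (k : ℝ)).const_mul (C : ℝ)
    simpa using this
  have hone : ∀ᶠ ε in 𝓝[>] (0 : ℝ), ε < 1 := nhdsWithin_le_nhds (Iio_mem_nhds zero_lt_one)
  have hpos : ∀ᶠ ε in 𝓝[>] (0 : ℝ), 0 < ε := self_mem_nhdsWithin
  obtain ⟨ε, hεη, hε1, hε⟩ :=
    ((hlim.eventually (Iio_mem_nhds hη)).and (hone.and hpos)).exists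
  refine ⟨ENNReal.ofReal ε, by positivity, ?_⟩
  filter_upwards [hm.eventually_ge_atTop 1] with n hn
  rintro _ ⟨Q, g, hg, hgf, rfl⟩
  have hFM : F ∈ DensityClass d p M := ⟨f, hf, by rw [hMcoe]; exact le_add_self⟩
  have hQM : Q ∈ DensityClass d p M := by
    refine ⟨g, hg, ?_⟩
    have h1 : g = (fun y => g y - f y) + f := by
      ext y
      simp
    have hp1 : 1 ≤ p := (one_le_two.trans hp2.le)
    rw [h1, hMcoe]
    refine (eLpNorm_add_le (hg.2.1.sub hf.2.1).aestronglyMeasurable hf.2.1.aestronglyMeasurable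
      hp1).trans ?_
    gcongr
    refine ((le_max_right _ _).trans hgf.le).trans ?_
    rw [← ENNReal.ofReal_one]
    exact ENNReal.ofReal_le_ofReal (le_of_lt hε1)
  have htv := tvDist_le_of_eLpNorm_sub_le hf hg hε.le ((le_max_left _ _).trans hgf.le)
  obtain ⟨π, hπ, hvar⟩ := hγ ε hε F hFM Q hQM htv
  have := hf.1
  have := hg.1
  have := hπ.isProbabilityMeasure
  refine (abs_integral_standardizedJointLaw_sub_le hmeas
    (fun i => boundedFunctional_truncEuler hK q (r i)) hπ (m n) (hγ0 ε hε) (hvar (m n) hn)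
    hB hC).trans (le_of_lt hεη)

lemma ToZeroInProb.max {Ω : Type*} [MeasurableSpace Ω] {μ : Measure Ω} {Y Z : ℕ → Ω → ℝ≥0∞}
    (hY : ToZeroInProb μ Y) (hZ : ToZeroInProb μ Z) :
    ToZeroInProb μ fun n ω => max (Y n ω) (Z n ω) := by
  intro δ hδ
  have h := (hY δ hδ).add (hZ δ hδ)
  rw [add_zero] at h
  refine tendsto_of_tendsto_of_tendsto_of_le_of_le tendsto_const_nhds h (fun _ => bot_le)
    fun n => (measure_mono fun ω hω => ?_).trans (measure_union_le _ _)
  have hω' : δ ≤ Max.max (Y n ω) (Z n ω) := hω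
  exact le_max_iff.1 hω'

lemma ToZeroAS.max {Ω : Type*} [MeasurableSpace Ω] {μ : Measure Ω} {Y Z : ℕ → Ω → ℝ≥0∞}
    (hY : ToZeroAS μ Y) (hZ : ToZeroAS μ Z) :
    ToZeroAS μ fun n ω => max (Y n ω) (Z n ω) := by
  filter_upwards [hY, hZ] with ω h1 h2
  have := Tendsto.max h1 h2
  rwa [max_self] at this

end Main

end TruncEuler

end

theorem corollaryA7 {d : ℕ} (hd : 0 < d) (q : ℕ) (p : ℝ≥0∞) (hp2 : 2 < p) (hpq : 2 * (q : ℝ≥0∞) + 1 < p)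
    (K : TruncEuler.ComplexFamily d) (hK : TruncEuler.IsFiltration K)
    (hK1 : TruncEuler.CondK1 K) (hD1 : TruncEuler.CondD1 K)
    {k : ℕ} (r : Fin k → ℝ) (χ : Fin k → Multiset (TruncEuler.E d) → ℝ)
    (hχ : χ = fun i S => TruncEuler.truncEuler q (K (r i) S))
    (hmeas : ∀ i, TruncEuler.MeasurableFunctional (χ i))
    (F : Measure (TruncEuler.E d)) (f : TruncEuler.E d → ℝ) (hf : TruncEuler.IsDensity f F)
    (hfp : eLpNorm f p volume < ∞) :
    -- bootstrap consistency
    (∀ {Ω : Type*} [MeasurableSpace Ω] (μ : Measure Ω) [IsProbabilityMeasure μ]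
      -- the data
      (X : ℕ → Ω → TruncEuler.E d) (_ : ∀ i, Measurable (X i)) (_ : iIndepFun X μ)
      (_ : ∀ i, μ.map (X i) = F)
      -- the estimated distribution and its density, as functions of the data
      (Fhat : (n : ℕ) → (Fin n → TruncEuler.E d) → Measure (TruncEuler.E d))
      (fhat : (n : ℕ) → (Fin n → TruncEuler.E d) → TruncEuler.E d → ℝ)
      (_ : ∀ n, 1 ≤ n → ∀ᵐ ω ∂μ,
        TruncEuler.IsDensity (fhat n fun i => X i ω) (Fhat n fun i => X i ω))
      (m : ℕ → ℕ) (_ : Tendsto m atTop atTop)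
      (G : Measure (Fin k → ℝ)) (_ : IsProbabilityMeasure G),
      -- version in probability
      (TruncEuler.ToZeroInProb μ (TruncEuler.densityError 1 fhat f X) →
        TruncEuler.ToZeroInProb μ (TruncEuler.densityError p fhat f X) →
        (TruncEuler.WeakConv (fun n => TruncEuler.standardizedJointLaw χ n F) G →
          TruncEuler.WeakConvInProb μ (TruncEuler.bootstrapLaw χ m Fhat X) G) ∧
        (TruncEuler.WeakConv (fun n => TruncEuler.standardizedJointLaw χ (m n) F) G ↔
          TruncEuler.WeakConvInProb μ (TruncEuler.bootstrapLaw χ m Fhat X) G) ∧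
        ((∀ᶠ N in atTop, N ∈ Set.range m) →
          (TruncEuler.WeakConv (fun n => TruncEuler.standardizedJointLaw χ n F) G ↔
          TruncEuler.WeakConvInProb μ (TruncEuler.bootstrapLaw χ m Fhat X) G))) ∧
      -- almost sure version
      (TruncEuler.ToZeroAS μ (TruncEuler.densityError 1 fhat f X) →
        TruncEuler.ToZeroAS μ (TruncEuler.densityError p fhat f X) →
        (TruncEuler.WeakConv (fun n => TruncEuler.standardizedJointLaw χ n F) G →
          TruncEuler.WeakConvAS μ (TruncEuler.bootstrapLaw χ m Fhat X) G) ∧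
        (TruncEuler.WeakConv (fun n => TruncEuler.standardizedJointLaw χ (m n) F) G ↔
          TruncEuler.WeakConvAS μ (TruncEuler.bootstrapLaw χ m Fhat X) G) ∧
        ((∀ᶠ N in atTop, N ∈ Set.range m) →
          (TruncEuler.WeakConv (fun n => TruncEuler.standardizedJointLaw χ n F) G ↔
          TruncEuler.WeakConvAS μ (TruncEuler.bootstrapLaw χ m Fhat X) G)))) ∧
    -- rates
    (∀ M : ℝ≥0, eLpNorm f p volume ≤ M →
      ∃ γ : ℝ → ℝ, γ =O[𝓝[>] 0] TruncEuler.rate q p ∧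
        ∀ ε : ℝ, 0 < ε → ∀ Q ∈ TruncEuler.DensityClass d p M, TruncEuler.tvDist F Q ≤ ε →
          -- iid pairs with marginals `F` and `Q`
          (∃ π : Measure (TruncEuler.E d × TruncEuler.E d), TruncEuler.IsCoupling π F Q ∧
            ∀ n : ℕ, 1 ≤ n → ∀ i,
              evariance (fun w : Fin n → TruncEuler.E d × TruncEuler.E d =>
                (√(n : ℝ))⁻¹ * (χ i (TruncEuler.scaledSample n fun j => (w j).1) -
                  χ i (TruncEuler.scaledSample n fun j => (w j).2)))
                (Measure.pi fun _ => π) ≤ ENNReal.ofReal (γ ε)) ∧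
          ∀ n : ℕ, 1 ≤ n → ∀ i,
            TruncEuler.W2 (TruncEuler.standardizedLaw (χ i) n F)
              (TruncEuler.standardizedLaw (χ i) n Q) ≤ ENNReal.ofReal √(γ ε)) := by
  subst hχ
  have := hf.1
  refine ⟨?_, ?_⟩
  · intro Ω _ μ _ X _ _ _ Fhat fhat hdens m hm G _
    have hA : ∀ n, IsProbabilityMeasure (TruncEuler.standardizedJointLaw
        (fun i S => TruncEuler.truncEuler q (K (r i) S)) (m n) F) := fun n =>
      TruncEuler.isProbabilityMeasure_standardizedJointLaw hmeas (m n) F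
    have hR : ∀ n ε, ∀ L ∈ TruncEuler.lawsNear
        (fun i S => TruncEuler.truncEuler q (K (r i) S)) p f (m n) ε, IsProbabilityMeasure L := by
      rintro n ε _ ⟨Q, g, hg, -, rfl⟩
      have := hg.1
      exact TruncEuler.isProbabilityMeasure_standardizedJointLaw hmeas (m n) Q
    have hmono : ∀ n, Monotone (TruncEuler.lawsNear
        (fun i S => TruncEuler.truncEuler q (K (r i) S)) p f (m n)) := by
      rintro n ε ε' hε _ ⟨Q, g, hg, hgf, rfl⟩
      exact ⟨Q, g, hg, hgf.trans_le hε, rfl⟩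
    have hclose := TruncEuler.uniformlyClose_lawsNear hd q hp2 hpq hK hK1 hD1 r hmeas hf hfp hm
    have hB : ∀ n, 1 ≤ n → ∀ᵐ ω ∂μ, ∀ ε, max (TruncEuler.densityError 1 fhat f X n ω)
        (TruncEuler.densityError p fhat f X n ω) < ε →
        TruncEuler.bootstrapLaw (fun i S => TruncEuler.truncEuler q (K (r i) S)) m Fhat X n ω ∈
          TruncEuler.lawsNear (fun i S => TruncEuler.truncEuler q (K (r i) S)) p f (m n) ε := by
      intro n hn
      filter_upwards [hdens n hn] with ω hω ε hε
      exact ⟨_, _, hω, hε, rfl⟩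
    constructor
    · intro h1 hp
      -- This is item 2; the other items compare `n` with `m n` for the law under `F` alone.
      have key := hclose.weakConv_iff_weakConvInProb (G := G) hA hR hmono
        (eventually_atTop.2 ⟨1, hB⟩) (h1.max hp)
      exact ⟨fun h => key.1 (h.comp hm), key, fun hrange =>
        ⟨fun h => key.1 (h.comp hm), fun h => TruncEuler.weakConv_of_comp hrange (key.2 h)⟩⟩
    · intro h1 hp
      have hB' : ∀ᵐ ω ∂μ, ∀ᶠ n in atTop, ∀ ε, max (TruncEuler.densityError 1 fhat f X n ω)
          (TruncEuler.densityError p fhat f X n ω) < ε →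
          TruncEuler.bootstrapLaw (fun i S => TruncEuler.truncEuler q (K (r i) S)) m Fhat X n ω ∈
            TruncEuler.lawsNear (fun i S => TruncEuler.truncEuler q (K (r i) S)) p f (m n) ε := by
        have h2 : ∀ᵐ ω ∂μ, ∀ n, 1 ≤ n → ∀ ε, max (TruncEuler.densityError 1 fhat f X n ω)
            (TruncEuler.densityError p fhat f X n ω) < ε →
            TruncEuler.bootstrapLaw (fun i S => TruncEuler.truncEuler q (K (r i) S)) m Fhat X n ω ∈
              TruncEuler.lawsNear (fun i S => TruncEuler.truncEuler q (K (r i) S)) p f (m n) ε := by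
          -- Countably many sample sizes, so one null set serves them all.
          refine ae_all_iff.2 fun n => ?_
          by_cases hn : 1 ≤ n
          · filter_upwards [hB n hn] with ω hω _
            exact hω
          · exact ae_of_all _ fun ω h => absurd h hn
        filter_upwards [h2] with ω hω
        exact eventually_atTop.2 ⟨1, hω⟩
      have key := hclose.weakConv_iff_weakConvAS (G := G) hA hR hmono hB' (h1.max hp)
      exact ⟨fun h => key.1 (h.comp hm), key, fun hrange =>
        ⟨fun h => key.1 (h.comp hm), fun h => TruncEuler.weakConv_of_comp hrange (key.2 h)⟩⟩
  · intro M hM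
    obtain ⟨γ, hγ0, hγO, hγ⟩ :=
      TruncEuler.exists_coupling_evariance_le hd q hp2 hpq hK hK1 hD1 r hmeas M
    refine ⟨γ, hγO, fun ε hε Q hQ htv => ?_⟩
    obtain ⟨π, hπ, hvar⟩ := hγ ε hε F ⟨f, hf, hM⟩ Q hQ htv
    have := TruncEuler.isProbabilityMeasure_of_mem hQ
    have := hπ.isProbabilityMeasure
    exact ⟨⟨π, hπ, hvar⟩, fun n hn i => TruncEuler.W2_le (hmeas i)
      (TruncEuler.boundedFunctional_truncEuler hK q (r i)) hπ n (hγ0 ε hε) (hvar n hn i)⟩
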